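/- **Setting.** Let $1\le T\in\mathbb N$, let $B(0)=1$, $B(1),\dots,B(T)>0$ be a deterministic bank account and $D(t)=B(t)^{-1}$. A *model* is a finite probability space with a filtration $(\mathcal F_t)_{0\le t\le T}$ and adapted processes $\underline S,S^C,\overline S$ (bid, reference and ask price of the underlying) with $0<\underline S_t\le S^C_t\le\overline S_t$ a.s. for $0\le t\le T$. Let $\epsilon\ge 0$. A call option is cash-settled against $S^C$; the option with maturity $t$ and discounted strike $k$ pays $(S^C_t-B(t)k)^+$ at time $t$. Given bid and ask prices at time $0$ of the underlying and of call options, a model is *$\epsilon$-consistent* with them if $\underline S_0,\overline S_0$ are a.s. equal to the given initial bid and ask price; $\mathbb E[(D(t)S^C_t-k)^+]$ lies between the given bid and ask price for every traded option (maturity $1\le t\le T$, discounted strike $k$); there is a process $S^*$ with $\underline S_t\le S^*_t\le\overline S_t$ a.s. for $0\le t\le T$ such that $(D(t)S^*_t)_{0\le t\le T}$ is a martingale; and $\overline S_t-\underline S_t\le\epsilon B(t)$, $S^C_t\ge\epsilon B(t)$ a.s. for all $0\le t\le T$. **Assumptions.** For every maturity $1\le t\le T$, options with all discounted strikes $k\in\mathbb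 R$ are traded, with equal bid and ask price $R_t(k)$; $R_t(k)=\int (y-k)^+\,\mu_t(dy)$ for a probability measure $\mu_t$ with finite support contained in $[\epsilon,\infty)$; the initial bid and ask price of the underlying are both equal to $S_0>0$, where $S_0\ge\epsilon$; and $\int y\,\mu_t(dy)\in[S_0-\epsilon,S_0+\epsilon]$. **Conditions.** For all $u\in\{2,\dots,T\}$ and all real $k_1,\dots,k_{u-1}$, writing $$\Sigma(\sigma_1,\sigma_u)=\sum_{t=1}^{u-1}\Bigl(R_{t+1}(k_t+\epsilon\sigma_{t+1})-R_t(k_t+\epsilon\sigma_t)\Bigr),\qquad \sigma_t=\operatorname{sgn}(k_{t-1}-k_t)\ \ (2\le t\le u-1),$$ the following hold: 1. $\Sigma(-1,1)+R_1(\epsilon)-R_u(\epsilon)+2\epsilon\ge 0$; 2. $\Sigma(-1,-1)+R_1(\epsilon)-S_0+2\epsilon\ge 0$; 3. $\Sigma(1,1)+S_0-R_u(\epsilon)\ge 0$; 4. $\Sigma(1,-1)\ge 0$. **Theorem.** Under these assumptions: (a) If an $\epsilon$-consistent model exists, then the conditions 1–4 hold. (b) If $\mu_t(\{\epsilon\})=0$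 for all $1\le t\le T$, then an $\epsilon$-consistent model exists if and only if the conditions 1–4 hold. (c) Without the restriction in (b), an $\epsilon$-consistent model in which the bid price is only required to satisfy $\underline S_t\ge 0$ instead of $\underline S_t>0$ exists if and only if the conditions 1–4 hold. -/

import Mathlib

open MeasureTheory ProbabilityTheory

noncomputable section

/-- Market data at time `0`: a deterministic bank account `B(0), …, B(T)`, the call options
traded for each maturity `1 ≤ t ≤ T` with their bid and ask prices, and the bid and ask prices of
the underlying. Options are indexed by the discounted strike `k`, i.e. the option with maturity `t`
and discounted strike `k` has strike `B(t) k`. Values at indices outside `0, …, T`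
(resp. `1, …, T` for options) are never used. -/
structure MarketData where
  /-- the time horizon -/
  T : ℕ
  one_le_T : 1 ≤ T
  /-- the bank account -/
  B : ℕ → ℝ
  B_pos : ∀ t ≤ T, 0 < B t
  B_zero : B 0 = 1
  /-- the discounted strikes of the traded options with maturity `t` -/
  strikes : ℕ → Set ℝ
  /-- bid prices of the options -/
  optBid : ℕ → ℝ → ℝ
  /-- ask prices of the options -/
  optAsk : ℕ → ℝ → ℝ
  /-- current bid price of the underlying -/
  bid₀ : ℝ
  /-- current ask price of the underlying -/
  ask₀ : ℝ
  bid₀_pos : 0 < bid₀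
  bid₀_le_ask₀ : bid₀ ≤ ask₀

/-- A finite filtered probability space with time set `{0, …, T}` and adapted processes
`bid ≤ ref ≤ ask` (bid price, reference price and ask price of the underlying), where the
bid price is nonnegative. Strict positivity of the bid price is the separate predicate
`BidAskModel.Positive`. -/
structure BidAskModel (T : ℕ) where
  Ω : Type
  finite : Finite Ω
  mΩ : MeasurableSpace Ω
  P : @Measure Ω mΩ
  isProb : @IsProbabilityMeasure Ω mΩ P
  ℱ : @Filtration Ω (Fin (T + 1)) _ mΩ
  bid : Fin (T + 1) → Ω → ℝ
  ref : Fin (T + 1) → Ω → ℝ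
  ask : Fin (T + 1) → Ω → ℝ
  adapted_bid : StronglyAdapted ℱ bid
  adapted_ref : StronglyAdapted ℱ ref
  adapted_ask : StronglyAdapted ℱ ask
  bid_nonneg : ∀ t, ∀ᵐ ω ∂P, 0 ≤ bid t ω
  bid_le_ref : ∀ t, ∀ᵐ ω ∂P, bid t ω ≤ ref t ω
  ref_le_ask : ∀ t, ∀ᵐ ω ∂P, ref t ω ≤ ask t ω

namespace BidAskModel

/-- The bid price process is strictly positive. -/
def Positive {T : ℕ} (M : BidAskModel T) : Prop :=
  ∀ t, ∀ᵐ ω ∂M.P, 0 < M.bid t ω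

/-- The model reproduces the given prices and admits a consistent price system `Sstar`
for the underlying. -/
structure IsConsistent (D : MarketData) (M : BidAskModel D.T) : Prop where
  bid_zero : ∀ᵐ ω ∂M.P, M.bid 0 ω = D.bid₀
  ask_zero : ∀ᵐ ω ∂M.P, M.ask 0 ω = D.ask₀
  option_price : ∀ t : Fin (D.T + 1), 1 ≤ (t : ℕ) → ∀ k ∈ D.strikes t,
    (∫ ω, max ((D.B t)⁻¹ * M.ref t ω - k) 0 ∂M.P) ∈ Set.Icc (D.optBid t k) (D.optAsk t k)
  exists_price_system : ∃ Sstar : Fin (D.T + 1) → M.Ω → ℝ,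
    (∀ t : Fin (D.T + 1), ∀ᵐ ω ∂M.P, M.bid t ω ≤ Sstar t ω ∧ Sstar t ω ≤ M.ask t ω) ∧
    Martingale (fun (t : Fin (D.T + 1)) ω => (D.B t)⁻¹ * Sstar t ω) M.ℱ M.P

/-- The model is consistent, its discounted bid-ask spread is bounded by `ε`, and its
discounted reference price is bounded below by `ε`. -/
structure IsEpsConsistent (D : MarketData) (ε : ℝ) (M : BidAskModel D.T) : Prop where
  consistent : M.IsConsistent D
  spread_le : ∀ t : Fin (D.T + 1), ∀ᵐ ω ∂M.P, M.ask t ω - M.bid t ω ≤ ε * D.B t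
  le_ref : ∀ t : Fin (D.T + 1), ∀ᵐ ω ∂M.P, ε * D.B t ≤ M.ref t ω

end BidAskModel

/-- The prices are `ε`-consistent with the absence of arbitrage: there is an `ε`-consistent model
(with strictly positive bid prices). -/
def EpsConsistent (D : MarketData) (ε : ℝ) : Prop :=
  ∃ M : BidAskModel D.T, M.Positive ∧ M.IsEpsConsistent D ε

/-- The same notion, except that the bid price of the underlying is allowed to vanish. -/
def EpsConsistentNonneg (D : MarketData) (ε : ℝ) : Prop :=
  ∃ M : BidAskModel D.T, M.IsEpsConsistent D ε

/-- The call function `x ↦ ∫ (y - x)⁺ μ(dy)` of a measure on the real line. -/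
def callFunction (μ : Measure ℝ) (x : ℝ) : ℝ :=
  ∫ y, max (y - x) 0 ∂μ

/-- For all maturities `1 ≤ t ≤ T`, all strikes are traded, bid and ask price of the option with
discounted strike `k` agree with `R t k`, and `R t` is the call function of a probability
measure `μ t` with finite support contained in `[ε, ∞)`. The initial bid and ask price of the
underlying are both `S₀`, and the mean of each `μ t` lies in `[S₀ - ε, S₀ + ε]`. -/
structure SimplifyingAssumptions (D : MarketData) (ε S₀ : ℝ) (R : ℕ → ℝ → ℝ)
    (μ : ℕ → Measure ℝ) : Prop where
  strikes_eq : ∀ t, 1 ≤ t → t ≤ D.T → D.strikes t = Set.univ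
  optBid_eq : ∀ t, 1 ≤ t → t ≤ D.T → ∀ k, D.optBid t k = R t k
  optAsk_eq : ∀ t, 1 ≤ t → t ≤ D.T → ∀ k, D.optAsk t k = R t k
  isProb : ∀ t, 1 ≤ t → t ≤ D.T → IsProbabilityMeasure (μ t)
  finite_support : ∀ t, 1 ≤ t → t ≤ D.T →
    ∃ F : Finset ℝ, (∀ x ∈ F, ε ≤ x) ∧ μ t ((F : Set ℝ)ᶜ) = 0
  R_eq : ∀ t, 1 ≤ t → t ≤ D.T → R t = callFunction (μ t)
  bid₀_eq : D.bid₀ = S₀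
  ask₀_eq : D.ask₀ = S₀
  mean_mem : ∀ t, 1 ≤ t → t ≤ D.T → (∫ y, y ∂μ t) ∈ Set.Icc (S₀ - ε) (S₀ + ε)

/-- The signs `σ_1, …, σ_u`: `σ_1 = s₁` and `σ_u = sᵤ` are prescribed, and
`σ_t = sgn (k_{t-1} - k_t)` for `2 ≤ t ≤ u - 1`. -/
def pathSign (k : ℕ → ℝ) (u : ℕ) (s₁ sᵤ : ℝ) (t : ℕ) : ℝ :=
  if t = 1 then s₁ else if t = u then sᵤ else Real.sign (k (t - 1) - k t)

/-- `∑_{t=1}^{u-1} (R_{t+1}(k_t + ε σ_{t+1}) - R_t(k_t + ε σ_t))` with `σ_1 = s₁`, `σ_u = sᵤ`. -/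
def pathSum (R : ℕ → ℝ → ℝ) (ε : ℝ) (k : ℕ → ℝ) (u : ℕ) (s₁ sᵤ : ℝ) : ℝ :=
  ∑ t ∈ Finset.Icc 1 (u - 1),
    (R (t + 1) (k t + ε * pathSign k u s₁ sᵤ (t + 1)) - R t (k t + ε * pathSign k u s₁ sᵤ t))

/-- The four families of inequalities, for all `u ∈ {2, …, T}` and all real `k_1, …, k_{u-1}`
(the other values of `k` are not used). -/
def PathConditions (T : ℕ) (R : ℕ → ℝ → ℝ) (ε S₀ : ℝ) : Prop :=
  ∀ u : ℕ, 2 ≤ u → u ≤ T → ∀ k : ℕ → ℝ,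
    0 ≤ pathSum R ε k u (-1) 1 + R 1 ε - R u ε + 2 * ε ∧
    0 ≤ pathSum R ε k u (-1) (-1) + R 1 ε - S₀ + 2 * ε ∧
    0 ≤ pathSum R ε k u 1 1 + S₀ - R u ε ∧
    0 ≤ pathSum R ε k u 1 (-1)

end

/-!
Suppose that `|X - Y| ≤ ε` and `X ≥ ε`, that `X` has the call function `R`, and that `Y` has a given
mean. Then the call function of `Y` lies between `lowerCall` and `upperCall`, and its increments are
bounded by the directed distance `callDist`. For a consistent price system, call prices with a fixed
strike increase with maturity since it is a martingale; hence a path of strikes that starts at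
`lowerCall` and ends at `upperCall` gives an inequality between the given prices. Reading off which
argument attains the maximum in `callDist` turns these inequalities into the path conditions.

Conversely, let `minCall` be the smallest sequence of functions, increasing in the maturity, which
dominates `lowerCall` and whose increments are bounded by `callDist`. By the path conditions it
stays below `upperCall`, and on a finite grid containing the kinks of all `R (· ± ε)` it is convex.
So it consists of call functions of laws that increase in the convex order. By the bound on the
increments, the monotone coupling with `μ t` moves no mass by more than `ε`, and by Strassen's
theorem the laws are the marginals of a martingale.
-/

section CallFunction

theorem integrable_call {Ω : Type*} {_ : MeasurableSpace Ω} {P : Measure Ω} [IsFiniteMeasure P]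
    {X : Ω → ℝ} (hX : Integrable X P) (k : ℝ) : Integrable (fun ω => max (X ω - k) 0) P :=
  (hX.sub (integrable_const k)).pos_part

theorem callFunction_map {Ω : Type*} {_ : MeasurableSpace Ω} {P : Measure Ω} {X : Ω → ℝ}
    (hX : AEMeasurable X P) (k : ℝ) : callFunction (P.map X) k = ∫ ω, max (X ω - k) 0 ∂P :=
  integral_map hX (by fun_prop)

theorem callFunction_nonneg (μ : Measure ℝ) (k : ℝ) : 0 ≤ callFunction μ k :=
  integral_nonneg fun _ => le_max_right _ _

theorem callFunction_eq_zero {μ : Measure ℝ} {k : ℝ} (h : ∀ᵐ y ∂μ, y ≤ k) :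
    callFunction μ k = 0 :=
  integral_eq_zero_of_ae (h.mono fun _ hy => max_eq_right (sub_nonpos.2 hy))

theorem convexOn_callFunction {μ : Measure ℝ} [IsFiniteMeasure μ]
    (hμ : Integrable (fun y => y) μ) : ConvexOn ℝ Set.univ (callFunction μ) :=
  integral_convexOn_of_integrand_ae convex_univ
    (.of_forall fun y => ((convexOn_const y convex_univ).sub (concaveOn_id convex_univ)).sup
      (convexOn_const 0 convex_univ))
    fun k _ => integrable_call hμ k

theorem callFunction_sub_callFunction {μ : Measure ℝ} [IsFiniteMeasure μ]
    (hμ : Integrable (fun y => y) μ) (a b : ℝ) :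
    callFunction μ b - callFunction μ a = ∫ y, (max (y - b) 0 - max (y - a) 0) ∂μ :=
  (integral_sub (integrable_call hμ b) (integrable_call hμ a)).symm

variable {μ : Measure ℝ} [IsProbabilityMeasure μ]

theorem callFunction_eq_mean_sub (hμ : Integrable (fun y => y) μ) {k : ℝ}
    (h : ∀ᵐ y ∂μ, k ≤ y) : callFunction μ k = ∫ y, y ∂μ - k := by
  rw [callFunction, integral_congr_ae (h.mono fun y hy => max_eq_left (sub_nonneg.2 hy)),
    integral_sub hμ (integrable_const k), integral_const, probReal_univ, one_smul]

theorem integral_const_mul_indicator_sub_one {s : Set ℝ} (hs : MeasurableSet s) (c : ℝ) :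
    ∫ y, c * (s.indicator 1 y - 1) ∂μ = c * (μ.real s - 1) := by
  rw [integral_const_mul, integral_sub ((integrable_const 1).indicator hs) (integrable_const 1),
    integral_indicator_one hs, integral_const, probReal_univ, one_smul]

theorem measureReal_Iic_sub_one_le_slope_callFunction (hμ : Integrable (fun y => y) μ) {a b : ℝ}
    (hab : a < b) : μ.real (Set.Iic a) - 1 ≤ slope (callFunction μ) a b := by
  rw [slope_def_field, le_div_iff₀' (sub_pos.2 hab), callFunction_sub_callFunction hμ,
    ← integral_const_mul_indicator_sub_one measurableSet_Iic]
  refine integral_mono ((((integrable_const 1).indicator measurableSet_Iic).sub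
    (integrable_const 1)).const_mul _) ((integrable_call hμ b).sub (integrable_call hμ a))
    fun y => ?_
  simp only [Set.indicator_apply, Set.mem_Iic, Pi.one_apply]
  split_ifs <;> grind

theorem slope_callFunction_le_measureReal_Iio_sub_one (hμ : Integrable (fun y => y) μ) {a b : ℝ}
    (hab : a < b) : slope (callFunction μ) a b ≤ μ.real (Set.Iio b) - 1 := by
  rw [slope_def_field, div_le_iff₀' (sub_pos.2 hab), callFunction_sub_callFunction hμ,
    ← integral_const_mul_indicator_sub_one measurableSet_Iio]
  refine integral_mono ((integrable_call hμ b).sub (integrable_call hμ a))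
    ((((integrable_const 1).indicator measurableSet_Iio).sub (integrable_const 1)).const_mul _)
    fun y => ?_
  simp only [Set.indicator_apply, Set.mem_Iio, Pi.one_apply]
  split_ifs <;> grind

end CallFunction

section CallBounds

theorem sub_le_sub_translate_of_convexOn {f : ℝ → ℝ} (hf : ConvexOn ℝ Set.univ f) {a b δ : ℝ}
    (hab : a ≤ b) (hδ : 0 ≤ δ) : f b - f a ≤ f (b + δ) - f (a + δ) := by
  rcases hab.eq_or_lt with rfl | hab
  · simp
  have hslope : slope f a b ≤ slope f (a + δ) (b + δ) := by
    simp only [slope_def_field]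
    calc (f b - f a) / (b - a) ≤ (f (b + δ) - f a) / (b + δ - a) :=
          hf.secant_mono trivial trivial trivial hab.ne' (by linarith) (by linarith)
      _ = (f a - f (b + δ)) / (a - (b + δ)) := by rw [← neg_div_neg_eq, neg_sub, neg_sub]
      _ ≤ (f (a + δ) - f (b + δ)) / (a + δ - (b + δ)) :=
          hf.secant_mono trivial trivial trivial (by linarith) (by linarith) (by linarith)
      _ = (f (b + δ) - f (a + δ)) / (b + δ - (a + δ)) := by
          rw [← neg_div_neg_eq, neg_sub, neg_sub]
  rwa [slope_def_field, slope_def_field, add_sub_add_right_eq_sub,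
    div_le_div_iff_of_pos_right (sub_pos.2 hab)] at hslope

/-- The directed distance between strikes: if `R` is the call function of the law of `X`, it bounds
`𝔼[(Y - y)⁺] - 𝔼[(Y - x)⁺]` for every `Y` with `|X - Y| ≤ ε`. -/
def callDist (R : ℝ → ℝ) (ε x y : ℝ) : ℝ :=
  max (R (y + ε) - R (x + ε)) (R (y - ε) - R (x - ε))

/-- The lower bound for `𝔼[(Y - x)⁺]` over all `Y` of mean `m` with `|X - Y| ≤ ε`, where `X ≥ ε` has
a law with call function `R`. -/
def lowerCall (R : ℝ → ℝ) (ε m x : ℝ) : ℝ :=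
  max (R (x + ε)) (R (x - ε) + (m - 2 * ε - R ε))

/-- The upper bound for `𝔼[(Y - x)⁺]` over all `Y` of mean `m` with `|X - Y| ≤ ε`, where `X ≥ ε` has
a law with call function `R`. -/
def upperCall (R : ℝ → ℝ) (ε m x : ℝ) : ℝ :=
  min (R (x - ε)) (R (x + ε) + (m - R ε))

section Deterministic

variable {R : ℝ → ℝ} {ε m x y : ℝ}

@[simp]
theorem callDist_self (R : ℝ → ℝ) (ε x : ℝ) : callDist R ε x x = 0 := by
  simp [callDist]

theorem callDist_triangle (R : ℝ → ℝ) (ε x y z : ℝ) :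
    callDist R ε x z ≤ callDist R ε x y + callDist R ε y z := by
  unfold callDist
  grind

theorem callDist_eq_of_le (hR : ConvexOn ℝ Set.univ R) (hε : 0 ≤ ε) (hxy : x ≤ y) :
    callDist R ε x y = R (y + ε) - R (x + ε) := by
  refine max_eq_left ?_
  have h := sub_le_sub_translate_of_convexOn hR (sub_le_sub_right hxy ε) (by positivity : 0 ≤ 2 * ε)
  rwa [show y - ε + 2 * ε = y + ε by ring, show x - ε + 2 * ε = x + ε by ring] at h

theorem callDist_eq_of_ge (hR : ConvexOn ℝ Set.univ R) (hε : 0 ≤ ε) (hyx : y ≤ x) :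
    callDist R ε x y = R (y - ε) - R (x - ε) := by
  refine max_eq_right ?_
  have := callDist_eq_of_le hR hε hyx
  have := le_max_right (R (x + ε) - R (y + ε)) (R (x - ε) - R (y - ε))
  unfold callDist at *
  linarith

theorem lowerCall_sub_le_callDist (R : ℝ → ℝ) (ε m x y : ℝ) :
    lowerCall R ε m y - lowerCall R ε m x ≤ callDist R ε x y := by
  unfold lowerCall callDist
  grind

theorem upperCall_sub_le_callDist (R : ℝ → ℝ) (ε m x y : ℝ) :
    upperCall R ε m y - upperCall R ε m x ≤ callDist R ε x y := by
  unfold upperCall callDist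
  grind

theorem convexOn_lowerCall (hR : ConvexOn ℝ Set.univ R) (ε m : ℝ) :
    ConvexOn ℝ Set.univ (lowerCall R ε m) := by
  have hadd : ConvexOn ℝ Set.univ fun x => R (x + ε) := hR.translate_left ε
  have hsub : ConvexOn ℝ Set.univ fun x => R (x - ε) := hR.translate_left (-ε)
  exact hadd.sup (hsub.add_const _)

end Deterministic

section RandomVariables

variable {Ω : Type*} {_ : MeasurableSpace Ω} {P : Measure Ω} [IsFiniteMeasure P]
  {X Y : Ω → ℝ} {ε : ℝ}

theorem callFunction_map_sub_le_callDist (hX : Integrable X P) (hY : Integrable Y P)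
    (hXY : ∀ᵐ ω ∂P, |X ω - Y ω| ≤ ε) (a b : ℝ) :
    callFunction (P.map Y) b - callFunction (P.map Y) a ≤
      callDist (callFunction (P.map X)) ε a b := by
  simp only [callDist, callFunction_map hX.aemeasurable, callFunction_map hY.aemeasurable,
    ← integral_sub (integrable_call hX _) (integrable_call hX _),
    ← integral_sub (integrable_call hY _) (integrable_call hY _)]
  have hmono : ∀ {c d : ℝ},
      (∀ᵐ ω ∂P, max (Y ω - b) 0 - max (Y ω - a) 0 ≤ max (X ω - d) 0 - max (X ω - c) 0) →
      ∫ ω, (max (Y ω - b) 0 - max (Y ω - a) 0) ∂P ≤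
        ∫ ω, (max (X ω - d) 0 - max (X ω - c) 0) ∂P :=
    fun {c d} => integral_mono_ae ((integrable_call hY b).sub (integrable_call hY a))
      ((integrable_call hX d).sub (integrable_call hX c))
  rcases le_total a b with hab | hab
  · exact le_max_of_le_left (hmono (hXY.mono fun ω hω => by grind))
  · exact le_max_of_le_right (hmono (hXY.mono fun ω hω => by grind))

theorem callFunction_map_sub_const (hX : Integrable X P) (k : ℝ) {c : ℝ}
    (hc : ∀ᵐ ω ∂P, c ≤ X ω) :
    callFunction (P.map X) k - callFunction (P.map X) c =
      ∫ ω, (max (X ω - k) 0 - (X ω - c)) ∂P := by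
  rw [callFunction_map hX.aemeasurable, callFunction_map hX.aemeasurable,
    integral_congr_ae (hc.mono fun ω hω => max_eq_left (sub_nonneg.2 hω))]
  exact (integral_sub (integrable_call hX k) (hX.sub (integrable_const c))).symm

theorem callFunction_map_le_upperCall (hX : Integrable X P) (hY : Integrable Y P)
    (hXY : ∀ᵐ ω ∂P, |X ω - Y ω| ≤ ε) (hεX : ∀ᵐ ω ∂P, ε ≤ X ω) (k : ℝ) :
    callFunction (P.map Y) k ≤ upperCall (callFunction (P.map X)) ε (∫ ω, Y ω ∂P) k := by
  refine le_min ?_ ?_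
  · rw [callFunction_map hX.aemeasurable, callFunction_map hY.aemeasurable]
    exact integral_mono_ae (integrable_call hY _) (integrable_call hX _)
      (hXY.mono fun ω hω => by grind)
  · have hXε := (integrable_call hX (k + ε)).sub (hX.sub (integrable_const ε))
    calc callFunction (P.map Y) k
        = ∫ ω, max (Y ω - k) 0 ∂P := callFunction_map hY.aemeasurable k
      _ ≤ ∫ ω, (max (X ω - (k + ε)) 0 - (X ω - ε) + Y ω) ∂P :=
          integral_mono_ae (integrable_call hY k) (hXε.add hY)
            ((hXY.and hεX).mono fun ω hω => by grind)
      _ = ∫ ω, (max (X ω - (k + ε)) 0 - (X ω - ε)) ∂P + ∫ ω, Y ω ∂P := integral_add hXε hY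
      _ = callFunction (P.map X) (k + ε) + (∫ ω, Y ω ∂P - callFunction (P.map X) ε) := by
          rw [← callFunction_map_sub_const hX (k + ε) hεX]
          ring

theorem lowerCall_le_callFunction_map {P : Measure Ω} [IsProbabilityMeasure P] (hX : Integrable X P)
    (hY : Integrable Y P) (hXY : ∀ᵐ ω ∂P, |X ω - Y ω| ≤ ε) (hεX : ∀ᵐ ω ∂P, ε ≤ X ω)
    (k : ℝ) :
    lowerCall (callFunction (P.map X)) ε (∫ ω, Y ω ∂P) k ≤ callFunction (P.map Y) k := by
  refine max_le ?_ ?_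
  · rw [callFunction_map hX.aemeasurable, callFunction_map hY.aemeasurable]
    exact integral_mono_ae (integrable_call hX _) (integrable_call hY _)
      (hXY.mono fun ω hω => by grind)
  · have hXε := (integrable_call hX (k - ε)).sub (hX.sub (integrable_const ε))
    have hYε := hY.sub (integrable_const (2 * ε))
    calc callFunction (P.map X) (k - ε) + (∫ ω, Y ω ∂P - 2 * ε - callFunction (P.map X) ε)
        = ∫ ω, (max (X ω - (k - ε)) 0 - (X ω - ε)) ∂P + ∫ ω, (Y ω - 2 * ε) ∂P := by
          rw [← callFunction_map_sub_const hX (k - ε) hεX, integral_sub hY (integrable_const _),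
            integral_const, probReal_univ, one_smul]
          ring
      _ = ∫ ω, (max (X ω - (k - ε)) 0 - (X ω - ε) + (Y ω - 2 * ε)) ∂P :=
          (integral_add hXε hYε).symm
      _ ≤ ∫ ω, max (Y ω - k) 0 ∂P :=
          integral_mono_ae (hXε.add hYε) (integrable_call hY k) (hXY.mono fun ω hω => by grind)
      _ = callFunction (P.map Y) k := (callFunction_map hY.aemeasurable k).symm

end RandomVariables

end CallBounds

section PathConditions

theorem sum_range_succ_shift_sub (a b : ℕ → ℝ) (n : ℕ) :
    ∑ i ∈ Finset.range (n + 1), (a (i + 1) - b i) =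
      a (n + 1) - b 0 + ∑ i ∈ Finset.range n, (a (i + 1) - b (i + 1)) := by
  rw [Finset.sum_sub_distrib, Finset.sum_range_succ, Finset.sum_range_succ' b,
    Finset.sum_sub_distrib]
  ring

theorem pathSum_add_two (R : ℕ → ℝ → ℝ) (ε : ℝ) (k : ℕ → ℝ) (n : ℕ) (s₁ sᵤ : ℝ) :
    pathSum R ε k (n + 2) s₁ sᵤ = R (n + 2) (k (n + 1) + ε * sᵤ) - R 1 (k 1 + ε * s₁) +
      ∑ i ∈ Finset.range n, (R (i + 2) (k (i + 1) + ε * Real.sign (k (i + 1) - k (i + 2))) -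
        R (i + 2) (k (i + 2) + ε * Real.sign (k (i + 1) - k (i + 2)))) := by
  let σ := pathSign k (n + 2) s₁ sᵤ
  have hfirst : σ 1 = s₁ := if_pos rfl
  have hlast : σ (n + 2) = sᵤ := by simp [σ, pathSign]
  have hmiddle : ∀ i ∈ Finset.range n, σ (i + 2) = Real.sign (k (i + 1) - k (i + 2)) := by
    intro i hi
    rw [Finset.mem_range] at hi
    exact (if_neg (by omega)).trans (if_neg (by omega))
  calc pathSum R ε k (n + 2) s₁ sᵤ
      = ∑ i ∈ Finset.range (n + 1), (R (i + 2) (k (i + 1) + ε * σ (i + 2)) -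
          R (i + 1) (k (i + 1) + ε * σ (i + 1))) := by
        rw [pathSum, Nat.add_sub_assoc one_le_two, ← Finset.Ico_add_one_right_eq_Icc,
          Finset.sum_Ico_eq_sum_range]
        exact Finset.sum_congr rfl fun i _ => by rw [add_comm 1 i]
    _ = R (n + 2) (k (n + 1) + ε * σ (n + 2)) - R 1 (k 1 + ε * σ 1) +
          ∑ i ∈ Finset.range n, (R (i + 2) (k (i + 1) + ε * σ (i + 2)) -
            R (i + 2) (k (i + 2) + ε * σ (i + 2))) :=
        sum_range_succ_shift_sub (fun i => R (i + 1) (k i + ε * σ (i + 1)))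
          (fun i => R (i + 1) (k (i + 1) + ε * σ (i + 1))) n
    _ = _ := by
        rw [hfirst, hlast]
        exact congrArg _ (Finset.sum_congr rfl fun i hi => by rw [hmiddle i hi])

theorem sub_sign_eq_callDist {R : ℝ → ℝ} (hR : ConvexOn ℝ Set.univ R) {ε : ℝ} (hε : 0 ≤ ε)
    (x y : ℝ) : R (y + ε * Real.sign (y - x)) - R (x + ε * Real.sign (y - x)) =
      callDist R ε x y := by
  rcases lt_trichotomy y x with h | rfl | h
  · rw [callDist_eq_of_ge hR hε h.le, Real.sign_of_neg (sub_neg.2 h), mul_neg_one,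
      ← sub_eq_add_neg, ← sub_eq_add_neg]
  · rw [callDist_self, sub_self]
  · rw [callDist_eq_of_le hR hε h.le, Real.sign_of_pos (sub_pos.2 h), mul_one]

theorem pathConditions_iff {T : ℕ} {R : ℕ → ℝ → ℝ} {ε S₀ : ℝ} (hε : 0 ≤ ε)
    (hR : ∀ t ∈ Set.Icc 1 T, ConvexOn ℝ Set.univ (R t)) :
    PathConditions T R ε S₀ ↔ ∀ n, n + 2 ≤ T → ∀ k : ℕ → ℝ,
      lowerCall (R 1) ε S₀ (k 1) ≤ upperCall (R (n + 2)) ε S₀ (k (n + 1)) +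
        ∑ i ∈ Finset.range n, callDist (R (i + 2)) ε (k (i + 2)) (k (i + 1)) := by
  have hpath : ∀ n, n + 2 ≤ T → ∀ (k : ℕ → ℝ) (s₁ sᵤ : ℝ), pathSum R ε k (n + 2) s₁ sᵤ =
      R (n + 2) (k (n + 1) + ε * sᵤ) - R 1 (k 1 + ε * s₁) +
        ∑ i ∈ Finset.range n, callDist (R (i + 2)) ε (k (i + 2)) (k (i + 1)) := by
    intro n hn k s₁ sᵤ
    rw [pathSum_add_two, Finset.sum_congr rfl fun i hi => ?_]
    rw [Finset.mem_range] at hi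
    exact sub_sign_eq_callDist (hR _ ⟨by omega, by omega⟩) hε _ _
  have hforall : PathConditions T R ε S₀ ↔ ∀ n, n + 2 ≤ T → ∀ k : ℕ → ℝ,
      0 ≤ pathSum R ε k (n + 2) (-1) 1 + R 1 ε - R (n + 2) ε + 2 * ε ∧
      0 ≤ pathSum R ε k (n + 2) (-1) (-1) + R 1 ε - S₀ + 2 * ε ∧
      0 ≤ pathSum R ε k (n + 2) 1 1 + S₀ - R (n + 2) ε ∧
      0 ≤ pathSum R ε k (n + 2) 1 (-1) :=
    ⟨fun h n => h (n + 2) (by omega),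
      fun h u hu => by obtain ⟨n, rfl⟩ := Nat.exists_eq_add_of_le' hu; exact h n⟩
  rw [hforall]
  refine forall₃_congr fun n hn k => ?_
  simp only [hpath n hn, mul_one, mul_neg_one, ← sub_eq_add_neg, lowerCall, upperCall,
    ← sub_le_iff_le_add, le_min_iff]
  grind

end PathConditions

theorem integral_call_mono_of_martingale {Ω ι : Type*} {m : MeasurableSpace Ω} {P : Measure Ω}
    [IsFiniteMeasure P] [Preorder ι] {ℱ : Filtration ι m} {Y : ι → Ω → ℝ} (hY : Martingale Y ℱ P)
    {i j : ι} (hij : i ≤ j) (k : ℝ) :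
    ∫ ω, max (Y i ω - k) 0 ∂P ≤ ∫ ω, max (Y j ω - k) 0 ∂P := by
  have hpos := (hY.sub (martingale_const ℱ P k)).submartingale.pos.setIntegral_le hij .univ
  rwa [Measure.restrict_univ] at hpos

namespace SimplifyingAssumptions

variable {D : MarketData} {ε S₀ : ℝ} {R : ℕ → ℝ → ℝ} {μ : ℕ → Measure ℝ} {t : ℕ}

theorem ae_ge (hA : SimplifyingAssumptions D ε S₀ R μ) (ht : t ∈ Set.Icc 1 D.T) :
    ∀ᵐ y ∂μ t, ε ≤ y := by
  obtain ⟨F, hF, hμF⟩ := hA.finite_support t ht.1 ht.2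
  exact measure_mono_null (fun y hy hyF => hy (hF y hyF)) hμF

theorem integrable (hA : SimplifyingAssumptions D ε S₀ R μ) (ht : t ∈ Set.Icc 1 D.T) :
    Integrable (fun y => y) (μ t) := by
  have := hA.isProb t ht.1 ht.2
  obtain ⟨F, -, hμF⟩ := hA.finite_support t ht.1 ht.2
  obtain ⟨C, hC⟩ := F.finite_toSet.isBounded.exists_norm_le
  exact .of_bound aestronglyMeasurable_id C (measure_mono_null (fun y hy hyF => hy (hC y hyF)) hμF)

theorem convexOn (hA : SimplifyingAssumptions D ε S₀ R μ) (ht : t ∈ Set.Icc 1 D.T) :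
    ConvexOn ℝ Set.univ (R t) := by
  have := hA.isProb t ht.1 ht.2
  exact hA.R_eq t ht.1 ht.2 ▸ convexOn_callFunction (hA.integrable ht)

end SimplifyingAssumptions

section Necessity

theorem pathConditions_of_increasing {T : ℕ} {R C : ℕ → ℝ → ℝ} {ε S₀ : ℝ} (hε : 0 ≤ ε)
    (hR : ∀ t ∈ Set.Icc 1 T, ConvexOn ℝ Set.univ (R t))
    (hmono : ∀ t ∈ Set.Ico 1 T, ∀ k, C t k ≤ C (t + 1) k)
    (hdist : ∀ t ∈ Set.Icc 1 T, ∀ a b, C t b - C t a ≤ callDist (R t) ε a b)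
    (hlower : ∀ k, lowerCall (R 1) ε S₀ k ≤ C 1 k)
    (hupper : ∀ t ∈ Set.Icc 1 T, ∀ k, C t k ≤ upperCall (R t) ε S₀ k) :
    PathConditions T R ε S₀ := by
  rw [pathConditions_iff hε hR]
  intro n hn k
  have hchain : ∀ j, j + 2 ≤ T → C 1 (k 1) ≤ C (j + 2) (k (j + 1)) +
      ∑ i ∈ Finset.range j, callDist (R (i + 2)) ε (k (i + 2)) (k (i + 1)) := by
    intro j
    induction j with
    | zero => intro hj; simpa using hmono 1 ⟨le_rfl, hj⟩ (k 1)
    | succ j ih =>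
      intro hj
      rw [Finset.sum_range_succ]
      linarith [ih (by omega), hmono (j + 2) ⟨by omega, hj⟩ (k (j + 2)),
        hdist (j + 2) ⟨by omega, by omega⟩ (k (j + 2)) (k (j + 1))]
  linarith [hchain n hn, hlower (k 1),
    hupper (n + 2) ⟨by omega, hn⟩ (k (n + 1))]

attribute [local instance] BidAskModel.mΩ BidAskModel.isProb

namespace BidAskModel

/-- The discounted reference price `D(t) S^C_t`. -/
noncomputable def discountedRef {D : MarketData} (M : BidAskModel D.T) (t : Fin (D.T + 1))
    (ω : M.Ω) : ℝ :=
  (D.B t)⁻¹ * M.ref t ω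

theorem measurable_discountedRef {D : MarketData} (M : BidAskModel D.T) (t : Fin (D.T + 1)) :
    Measurable (M.discountedRef t) :=
  (((M.adapted_ref t).mono (M.ℱ.le t)).const_mul _).measurable

namespace IsEpsConsistent

variable {D : MarketData} {ε S₀ : ℝ} {R : ℕ → ℝ → ℝ} {μ : ℕ → Measure ℝ} {M : BidAskModel D.T}

theorem ae_le_discountedRef (hM : M.IsEpsConsistent D ε) (t : Fin (D.T + 1)) :
    ∀ᵐ ω ∂M.P, ε ≤ M.discountedRef t ω := by
  filter_upwards [hM.le_ref t] with ω hω
  rwa [discountedRef, inv_mul_eq_div, le_div_iff₀ (D.B_pos t (by omega))]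

theorem exists_martingale_near (hM : M.IsEpsConsistent D ε) (hbid : D.bid₀ = S₀)
    (hask : D.ask₀ = S₀) : ∃ Y : Fin (D.T + 1) → M.Ω → ℝ, Martingale Y M.ℱ M.P ∧
      (∀ t, ∀ᵐ ω ∂M.P, |M.discountedRef t ω - Y t ω| ≤ ε) ∧ ∀ᵐ ω ∂M.P, Y 0 ω = S₀ := by
  obtain ⟨S, hS, hmart⟩ := hM.consistent.exists_price_system
  refine ⟨_, hmart, fun t => ?_, ?_⟩
  · filter_upwards [hS t, M.bid_le_ref t, M.ref_le_ask t, hM.spread_le t]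
      with ω hSω hbid_ref href_ask hspread
    have hB := D.B_pos t (by omega)
    rw [discountedRef, ← mul_sub, abs_mul, abs_of_pos (inv_pos.2 hB), inv_mul_le_iff₀' hB, abs_le]
    constructor <;> linarith [hSω.1, hSω.2]
  · filter_upwards [hS 0, hM.consistent.bid_zero, hM.consistent.ask_zero] with ω hSω hbidω haskω
    rw [hbidω, haskω, hbid, hask] at hSω
    simp [D.B_zero, le_antisymm hSω.2 hSω.1]

theorem callFunction_map_discountedRef (hM : M.IsEpsConsistent D ε)
    (hA : SimplifyingAssumptions D ε S₀ R μ) {t : Fin (D.T + 1)} (ht : 1 ≤ (t : ℕ)) :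
    callFunction (M.P.map (M.discountedRef t)) = R t := by
  have htT : (t : ℕ) ≤ D.T := by omega
  funext k
  have hprice := hM.consistent.option_price t ht k (hA.strikes_eq t ht htT ▸ Set.mem_univ k)
  rw [hA.optBid_eq t ht htT, hA.optAsk_eq t ht htT] at hprice
  exact (callFunction_map (M.measurable_discountedRef t).aemeasurable k).trans
    (le_antisymm hprice.2 hprice.1)

end IsEpsConsistent

end BidAskModel

theorem pathConditions_of_epsConsistentNonneg {D : MarketData} {ε S₀ : ℝ} {R : ℕ → ℝ → ℝ}
    {μ : ℕ → Measure ℝ} (hA : SimplifyingAssumptions D ε S₀ R μ) (hε : 0 ≤ ε)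
    (h : EpsConsistentNonneg D ε) : PathConditions D.T R ε S₀ := by
  obtain ⟨M, hM⟩ := h
  obtain ⟨Y, hmart, hXY, hY₀⟩ := hM.exists_martingale_near hA.bid₀_eq hA.ask₀_eq
  have hY := hmart.integrable
  have hX : ∀ t, Integrable (M.discountedRef t) M.P := fun t => by
    have hdiff := Integrable.of_bound ((M.measurable_discountedRef t).aestronglyMeasurable.sub
      (hY t).aestronglyMeasurable) ε (hXY t)
    simpa using hdiff.add (hY t)
  have hmean : ∀ t, ∫ ω, Y t ω ∂M.P = S₀ := fun t => by
    have hconst := hmart.setIntegral_eq (Fin.zero_le t) .univ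
    rw [Measure.restrict_univ, integral_congr_ae hY₀, integral_const, probReal_univ, one_smul]
      at hconst
    exact hconst.symm
  let time (t : ℕ) : Fin (D.T + 1) := Fin.ofNat _ t
  have htime : ∀ {t}, t ≤ D.T → (time t : ℕ) = t := fun ht => Nat.mod_eq_of_lt (by omega)
  have hR : ∀ t ∈ Set.Icc 1 D.T, R t = callFunction (M.P.map (M.discountedRef (time t))) :=
    fun t ht => by
      rw [hM.callFunction_map_discountedRef hA (by rw [htime ht.2]; exact ht.1), htime ht.2]
  refine pathConditions_of_increasing (C := fun t => callFunction (M.P.map (Y (time t)))) hε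
    (fun t ht => hA.convexOn ht) (fun t ht k => ?_) (fun t ht a b => ?_) (fun k => ?_)
    (fun t ht k => ?_)
  · simp only [callFunction_map (hY _).aemeasurable]
    exact integral_call_mono_of_martingale hmart
      (Fin.le_def.2 (by rw [htime ht.2.le, htime ht.2]; exact t.le_succ)) k
  · rw [hR t ht]
    exact callFunction_map_sub_le_callDist (hX _) (hY _) (hXY _) a b
  · rw [hR 1 ⟨le_rfl, D.one_le_T⟩, ← hmean (time 1)]
    exact lowerCall_le_callFunction_map (hX _) (hY _) (hXY _) (hM.ae_le_discountedRef _) k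
  · rw [hR t ht, ← hmean (time t)]
    exact callFunction_map_le_upperCall (hX _) (hY _) (hXY _) (hM.ae_le_discountedRef _) k

end Necessity

section Coupling

variable {α β : Type*} [Fintype α] [Fintype β]

/-- A coupling `J` of two weight functions on finite types, given by its joint weights. -/
structure IsCoupling (p : α → ℝ) (q : β → ℝ) (J : α → β → ℝ) : Prop where
  nonneg : ∀ a b, 0 ≤ J a b
  sum_right : ∀ a, ∑ b, J a b = p a
  sum_left : ∀ b, ∑ a, J a b = q b

/-- The convex order between the law with weights `p` at the points `y` and the law with weights
`q` at the points `z`. -/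
def ConvexOrderLE (p : α → ℝ) (y : α → ℝ) (q : β → ℝ) (z : β → ℝ) : Prop :=
  ∀ φ : ℝ → ℝ, ConvexOn ℝ Set.univ φ → ∑ a, p a * φ (y a) ≤ ∑ b, q b * φ (z b)

section Quantile

/-- The length of the intersection of the intervals `[l, r]` and `[l', r']`, where `l ≤ r` and
`l' ≤ r'`. -/
noncomputable def overlap (l r l' r' : ℝ) : ℝ := max l (min r r') - max l (min r l')

theorem overlap_comm {l r l' r' : ℝ} (h : l ≤ r) (h' : l' ≤ r') :
    overlap l r l' r' = overlap l' r' l r := by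
  unfold overlap
  grind

theorem overlap_nonneg {l r l' r' : ℝ} (h' : l' ≤ r') : 0 ≤ overlap l r l' r' :=
  sub_nonneg.2 (max_le_max_left _ (min_le_min_left _ h'))

theorem lt_of_overlap_ne_zero {l r l' r' : ℝ} (h : l ≤ r) (h' : l' ≤ r')
    (hne : overlap l r l' r' ≠ 0) : l < r' ∧ l' < r := by
  unfold overlap at hne
  grind

theorem sum_apply_sum_le_sub_apply_sum_lt {γ : Type*} [LinearOrder γ] (q : γ → ℝ) (h : ℝ → ℝ)
    (s : Finset γ) : ∑ b ∈ s, (h (∑ c ∈ s with c ≤ b, q c) - h (∑ c ∈ s with c < b, q c)) =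
      h (∑ c ∈ s, q c) - h 0 := by
  induction s using Finset.induction_on_max with
  | empty => simp
  | insert a s ha ih =>
    have hle : (insert a s).filter (· ≤ a) = insert a s :=
      Finset.filter_true_of_mem
        (Finset.forall_mem_insert _ _ _ |>.2 ⟨le_rfl, fun x hx => (ha x hx).le⟩)
    have hlt : (insert a s).filter (· < a) = s := by
      rw [Finset.filter_insert, if_neg (lt_irrefl a), Finset.filter_true_of_mem ha]
    have hbelow : ∑ b ∈ s, (h (∑ c ∈ insert a s with c ≤ b, q c) -
        h (∑ c ∈ insert a s with c < b, q c)) = h (∑ c ∈ s, q c) - h 0 := by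
      rw [← ih]
      refine Finset.sum_congr rfl fun b hb => ?_
      rw [Finset.filter_insert, Finset.filter_insert, if_neg (ha b hb).not_ge,
        if_neg (ha b hb).not_gt]
    rw [Finset.sum_insert fun has => lt_irrefl a (ha a has), hle, hlt, hbelow, sub_add_sub_cancel]

variable [LinearOrder α] [LinearOrder β] {p : α → ℝ} {q : β → ℝ}

theorem sum_lt_add_self (p : α → ℝ) (a : α) :
    ∑ c with c < a, p c + p a = ∑ c with c ≤ a, p c := by
  have hinsert :
      (Finset.univ.filter (· ≤ a) : Finset α) = insert a (Finset.univ.filter (· < a)) := by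
    ext c
    simp [le_iff_eq_or_lt]
  rw [hinsert, Finset.sum_insert (by simp), add_comm]

theorem sum_lt_le_sum_le (hp : 0 ≤ p) (a : α) : ∑ c with c < a, p c ≤ ∑ c with c ≤ a, p c :=
  sum_lt_add_self p a ▸ le_add_of_nonneg_right (hp a)

theorem sum_overlap (hq : ∑ b, q b = 1) {l r : ℝ} (hl : 0 ≤ l) (hlr : l ≤ r) (hr : r ≤ 1) :
    ∑ b, overlap l r (∑ c with c < b, q c) (∑ c with c ≤ b, q c) = r - l := by
  unfold overlap
  rw [sum_apply_sum_le_sub_apply_sum_lt q (fun v => max l (min r v)), hq, min_eq_left hr,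
    max_eq_right hlr, min_eq_right (hl.trans hlr), max_eq_left hl]

theorem sum_overlap_cdf (hp : p ∈ stdSimplex ℝ α) (hq : ∑ b, q b = 1) (a : α) :
    ∑ b, overlap (∑ c with c < a, p c) (∑ c with c ≤ a, p c)
      (∑ c with c < b, q c) (∑ c with c ≤ b, q c) = p a := by
  have hle : ∑ c with c ≤ a, p c ≤ 1 := hp.2 ▸
    Finset.sum_le_sum_of_subset_of_nonneg (Finset.filter_subset _ _) fun c _ _ => hp.1 c
  rw [sum_overlap hq (Finset.sum_nonneg fun c _ => hp.1 c) (sum_lt_le_sum_le hp.1 a) hle,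
    ← sum_lt_add_self p a, add_sub_cancel_left]

theorem exists_monotone_coupling (hp : p ∈ stdSimplex ℝ α) (hq : q ∈ stdSimplex ℝ β) :
    ∃ J, IsCoupling p q J ∧ ∀ a b, J a b ≠ 0 →
      ∑ c with c < a, p c < ∑ c with c ≤ b, q c ∧ ∑ c with c < b, q c < ∑ c with c ≤ a, p c := by
  have hp_le := sum_lt_le_sum_le hp.1
  have hq_le := sum_lt_le_sum_le hq.1
  refine ⟨fun a b => overlap (∑ c with c < a, p c) (∑ c with c ≤ a, p c)
    (∑ c with c < b, q c) (∑ c with c ≤ b, q c),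
    ⟨fun a b => overlap_nonneg (hq_le b), sum_overlap_cdf hp hq.2, fun b => ?_⟩,
    fun a b h => lt_of_overlap_ne_zero (hp_le a) (hq_le b) h⟩
  simp only [fun a => overlap_comm (hp_le a) (hq_le b)]
  exact sum_overlap_cdf hq hp.2 b

end Quantile

section Strassen

open Matrix

theorem exists_mem_stdSimplex_vecMul_eq {ι κ : Type*} [Fintype ι] [Fintype κ] {A : Matrix ι κ ℝ}
    {v : κ → ℝ} (h : ∀ (c : κ → ℝ) (u : ℝ), (∀ i, u ≤ A i ⬝ᵥ c) → u ≤ v ⬝ᵥ c) :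
    ∃ w ∈ stdSimplex ℝ ι, w ᵥ* A = v := by
  classical
  by_contra hv
  have hcompact : IsCompact (A.vecMulLinear '' stdSimplex ℝ ι) :=
    (isCompact_stdSimplex ℝ ι).image A.vecMulLinear.continuous_of_finiteDimensional
  obtain ⟨f, u, hfv, hf⟩ := geometric_hahn_banach_point_closed
    ((convex_stdSimplex ℝ ι).linear_image A.vecMulLinear) hcompact.isClosed hv
  obtain ⟨c, hfc⟩ : ∃ c, ∀ x, f x = x ⬝ᵥ c :=
    ⟨_, fun x => LinearMap.pi_apply_eq_sum_univ (f : (κ → ℝ) →ₗ[ℝ] ℝ) x⟩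
  refine (h c u fun i => ?_).not_gt (hfc v ▸ hfv)
  have hrow : A.vecMulLinear (Pi.single i 1) = A i := single_one_vecMul i A
  exact hfc (A i) ▸ hrow ▸ (hf _ ⟨_, single_mem_stdSimplex ℝ i, rfl⟩).le

theorem convexOn_sup'_affine {ι : Type*} {s : Finset ι} (hs : s.Nonempty) (a b : ι → ℝ) :
    ConvexOn ℝ Set.univ fun x => s.sup' hs fun i => a i + b i * x := by
  refine ⟨convex_univ, fun x _ y _ c d hc hd hcd => Finset.sup'_le _ _ fun i hi => ?_⟩
  have hx := s.le_sup' (fun i => a i + b i * x) hi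
  have hy := s.le_sup' (fun i => a i + b i * y) hi
  calc a i + b i * (c • x + d • y) = c * (a i + b i * x) + d * (a i + b i * y) := by
        rw [smul_eq_mul, smul_eq_mul]; linear_combination -(a i) * hcd
    _ ≤ _ := add_le_add (mul_le_mul_of_nonneg_left hx hc) (mul_le_mul_of_nonneg_left hy hd)

variable {p : α → ℝ} {q : β → ℝ} {y : α → ℝ} {z : β → ℝ}

theorem ConvexOrderLE.le_sum_add_sum [Nonempty α] (h : ConvexOrderLE p y q z)
    (hp : p ∈ stdSimplex ℝ α) (hq : 0 ≤ q) {f s : α → ℝ} {g : β → ℝ} {u : ℝ}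
    (hu : ∀ a b, u ≤ f a + g b + s a * (z b - y a)) : u ≤ ∑ a, p a * f a + ∑ b, q b * g b := by
  let φ : ℝ → ℝ := fun x => Finset.univ.sup' Finset.univ_nonempty
    fun a => u - f a + s a * y a + -s a * x
  have hle_φ : ∀ a, u - f a ≤ φ (y a) := fun a => by
    refine le_trans (le_of_eq ?_) (Finset.le_sup' _ (Finset.mem_univ a))
    ring
  have hφ_le : ∀ b, φ (z b) ≤ g b := fun b => Finset.sup'_le _ _ fun a _ => by linarith [hu a b]
  have hsum : u - ∑ a, p a * f a ≤ ∑ b, q b * g b :=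
    calc u - ∑ a, p a * f a = ∑ a, p a * (u - f a) := by
          simp only [mul_sub, Finset.sum_sub_distrib, ← Finset.sum_mul, hp.2, one_mul]
      _ ≤ ∑ a, p a * φ (y a) :=
          Finset.sum_le_sum fun a _ => mul_le_mul_of_nonneg_left (hle_φ a) (hp.1 a)
      _ ≤ ∑ b, q b * φ (z b) := h φ (convexOn_sup'_affine _ _ _)
      _ ≤ ∑ b, q b * g b :=
          Finset.sum_le_sum fun b _ => mul_le_mul_of_nonneg_left (hφ_le b) (hq b)
  linarith

-- Strassen's theorem: Hahn–Banach separates `(p, q, 0)` from the compact convex set of triples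
-- (first marginal, second marginal, drift) of all joint laws, and the separating functional yields
-- a maximum of affine functions that violates the convex order.
theorem ConvexOrderLE.exists_martingale_coupling [Nonempty α] (h : ConvexOrderLE p y q z)
    (hp : p ∈ stdSimplex ℝ α) (hq : 0 ≤ q) :
    ∃ J, IsCoupling p q J ∧ ∀ a, ∑ b, J a b * (z b - y a) = 0 := by
  classical
  let A : Matrix (α × β) (α ⊕ β ⊕ α) ℝ := .of fun i =>
    Sum.elim (Pi.single i.1 1) (Sum.elim (Pi.single i.2 1) (Pi.single i.1 (z i.2 - y i.1)))
  obtain ⟨w, hw, hwA⟩ : ∃ w ∈ stdSimplex ℝ (α × β), w ᵥ* A = Sum.elim p (Sum.elim q 0) := by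
    refine exists_mem_stdSimplex_vecMul_eq fun c u hc => ?_
    have hle := h.le_sum_add_sum hp hq (f := fun a => c (.inl a)) (g := fun b => c (.inr (.inl b)))
      (s := fun a => c (.inr (.inr a))) (u := u) fun a b => by
        refine (hc (a, b)).trans_eq ?_
        simp [A, dotProduct, Pi.single_apply]
        ring
    simpa [dotProduct] using hle
  refine ⟨fun a b => w (a, b), ⟨fun a b => hw.1 _, fun a => ?_, fun b => ?_⟩, fun a => ?_⟩
  · simpa [A, vecMul, dotProduct, Fintype.sum_prod_type_right, Pi.single_apply] using
      congrFun hwA (.inl a)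
  · simpa [A, vecMul, dotProduct, Fintype.sum_prod_type, Pi.single_apply] using
      congrFun hwA (.inr (.inl b))
  · simpa [A, vecMul, dotProduct, Fintype.sum_prod_type, Pi.single_apply] using
      congrFun hwA (.inr (.inr a))

end Strassen

end Coupling

section Grid

theorem slope_le_slope_of_convexOn {f : ℝ → ℝ} (hf : ConvexOn ℝ Set.univ f) {a x b : ℝ}
    (hax : a < x) (hxb : x < b) : slope f a x ≤ slope f x b := by
  simpa only [slope_def_field] using hf.slope_mono_adjacent trivial trivial hax hxb

/-- The mass at `g (j + 1)` of the law on the grid `g` whose call function agrees with `c` at the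
points of the grid, i.e. the second difference of `c`. -/
noncomputable def gridMass (g : ℕ → ℝ) (c : ℝ → ℝ) (j : ℕ) : ℝ :=
  slope c (g (j + 1)) (g (j + 2)) - slope c (g j) (g (j + 1))

theorem sum_range_gridMass (g : ℕ → ℝ) (c : ℝ → ℝ) (n : ℕ) :
    ∑ j ∈ Finset.range n, gridMass g c j = slope c (g n) (g (n + 1)) - slope c (g 0) (g 1) :=
  Finset.sum_range_sub (fun j => slope c (g j) (g (j + 1))) n

theorem sum_range_gridMass_mul_sub (g : ℕ → ℝ) (c : ℝ → ℝ) (x : ℝ) (n : ℕ) :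
    ∑ j ∈ Finset.range n, gridMass g c j * (x - g (j + 1)) =
      c (g n) + slope c (g n) (g (n + 1)) * (x - g n) -
        (c (g 0) + slope c (g 0) (g 1) * (x - g 0)) := by
  induction n with
  | zero => simp
  | succ n ih =>
    have hslope := sub_smul_slope c (g n) (g (n + 1))
    rw [smul_eq_mul, vsub_eq_sub] at hslope
    rw [Finset.sum_range_succ, ih, gridMass]
    linear_combination hslope

variable {g : ℕ → ℝ} {N : ℕ}

theorem sum_range_gridMass_mul_max_sub (hg : StrictMono g) (c : ℝ → ℝ) {i : ℕ} (hi : i ≤ N) :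
    ∑ j ∈ Finset.range N, gridMass g c j * max (g i - g (j + 1)) 0 =
      c (g i) - (c (g 0) + slope c (g 0) (g 1) * (g i - g 0)) := by
  have hle : ∀ j ∈ Finset.range i,
      gridMass g c j * max (g i - g (j + 1)) 0 = gridMass g c j * (g i - g (j + 1)) :=
    fun j hj => by rw [max_eq_left (sub_nonneg.2 (hg.monotone (Finset.mem_range.1 hj)))]
  have hgt : ∀ j ∈ Finset.range N, j ∉ Finset.range i →
      gridMass g c j * max (g i - g (j + 1)) 0 = 0 := fun j _ hj => by
    rw [Finset.mem_range, not_lt] at hj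
    rw [max_eq_right (sub_nonpos.2 (hg.monotone (hj.trans j.le_succ))), mul_zero]
  rw [← Finset.sum_subset (Finset.range_subset_range.2 hi) hgt, Finset.sum_congr rfl hle,
    sum_range_gridMass_mul_sub, sub_self, mul_zero, add_zero]

theorem sum_range_gridMass_mul_call (hg : StrictMono g) {c : ℝ → ℝ} {i : ℕ} (hi : i ≤ N)
    (hN : c (g N) = 0) (hN' : c (g (N + 1)) = 0) :
    ∑ j ∈ Finset.range N, gridMass g c j * max (g (j + 1) - g i) 0 = c (g i) := by
  have hparity : ∀ j, max (g (j + 1) - g i) 0 = max (g i - g (j + 1)) 0 - (g i - g (j + 1)) := by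
    grind
  simp only [hparity, mul_sub (gridMass g c _) (max _ _), Finset.sum_sub_distrib,
    sum_range_gridMass_mul_max_sub hg c hi, sum_range_gridMass_mul_sub, slope_def_field, hN, hN']
  ring

theorem sum_mul_comp_grid {α : Type*} [Fintype α] {p : α → ℝ} (hp : ∑ a, p a = 1) {ι : α → ℕ}
    (hg : StrictMono g) (hι : ∀ a, ι a ≤ N) (c : ℝ → ℝ) :
    ∑ a, p a * c (g (ι a)) =
      c (g 0) - slope c (g 0) (g 1) * g 0 + slope c (g 0) (g 1) * ∑ a, p a * g (ι a) +
        ∑ j ∈ Finset.range N, gridMass g c j * ∑ a, p a * max (g (ι a) - g (j + 1)) 0 := by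
  have hpoint : ∀ a, p a * c (g (ι a)) = p a * (c (g 0) - slope c (g 0) (g 1) * g 0) +
      slope c (g 0) (g 1) * (p a * g (ι a)) +
        ∑ j ∈ Finset.range N, gridMass g c j * (p a * max (g (ι a) - g (j + 1)) 0) := by
    intro a
    simp only [mul_left_comm _ (p a), ← Finset.mul_sum,
      sum_range_gridMass_mul_max_sub hg c (hι a)]
    ring
  simp only [hpoint, Finset.sum_add_distrib, ← Finset.sum_mul, hp, one_mul, ← Finset.mul_sum]
  rw [Finset.sum_comm]
  simp only [← Finset.mul_sum]

theorem ConvexOrderLE.of_calls_le {α β : Type*} [Fintype α] [Fintype β]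
    {p : α → ℝ} {q : β → ℝ} (hg : StrictMono g) (hp : ∑ a, p a = 1) (hq : ∑ b, q b = 1)
    {ι : α → ℕ} {κ : β → ℕ} (hι : ∀ a, ι a ≤ N) (hκ : ∀ b, κ b ≤ N)
    (hmean : ∑ a, p a * g (ι a) = ∑ b, q b * g (κ b))
    (hcall : ∀ j < N, ∑ a, p a * max (g (ι a) - g (j + 1)) 0 ≤
      ∑ b, q b * max (g (κ b) - g (j + 1)) 0) :
    ConvexOrderLE p (fun a => g (ι a)) q (fun b => g (κ b)) := by
  intro φ hφ
  rw [sum_mul_comp_grid hp hg hι φ, sum_mul_comp_grid hq hg hκ φ, hmean]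
  gcongr with j hj
  · exact sub_nonneg.2
      (slope_le_slope_of_convexOn hφ (hg j.lt_succ_self) (hg (j + 1).lt_succ_self))
  · exact hcall j (Finset.mem_range.1 hj)

end Grid

theorem exists_strictMono_of_finset (s : Finset ℝ) :
    ∃ (g : ℕ → ℝ) (N : ℕ), StrictMono g ∧ ∀ x ∈ s, ∃ i < N, g (i + 1) = x := by
  obtain ⟨C, hC, hs⟩ := s.finite_toSet.isBounded.exists_pos_norm_le
  let e := s.orderEmbOfFin rfl
  have he : ∀ i, -C ≤ e i ∧ e i ≤ C := fun i => abs_le.1 (hs _ (s.orderEmbOfFin_mem rfl i))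
  let g : ℕ → ℝ
    | 0 => -C - 1
    | i + 1 => if h : i < s.card then e ⟨i, h⟩ else C + i
  refine ⟨g, s.card, strictMono_nat_of_lt_succ fun i => ?_, fun x hx => ?_⟩
  · rcases i with _ | i <;> simp only [g] <;> split_ifs with h₁
    · linarith [(he ⟨0, h₁⟩).1]
    · push_cast; linarith
    · exact e.strictMono (Fin.mk_lt_mk.2 i.lt_succ_self)
    · push_cast; linarith [(he ⟨i, h₁⟩).2, (Nat.cast_nonneg i : (0 : ℝ) ≤ i)]
    · omega
    · push_cast; linarith
  · obtain ⟨i, rfl⟩ := (s.range_orderEmbOfFin rfl).ge hx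
    exact ⟨i, i.2, dif_pos i.2⟩

section Envelope

/-- The smallest function that dominates `f` on `s` and is nonexpansive for the directed
distance `d`, in the sense that `e y - e x ≤ d x y`. -/
noncomputable def envelope (s : Finset ℝ) (hs : s.Nonempty) (d : ℝ → ℝ → ℝ) (f : ℝ → ℝ)
    (x : ℝ) : ℝ :=
  s.sup' hs fun y => f y - d x y

variable {s : Finset ℝ} (hs : s.Nonempty) {d : ℝ → ℝ → ℝ} (f : ℝ → ℝ) {x y : ℝ}

theorem sub_le_envelope (d : ℝ → ℝ → ℝ) (x : ℝ) (hy : y ∈ s) :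
    f y - d x y ≤ envelope s hs d f x :=
  s.le_sup' (fun y => f y - d x y) hy

theorem exists_envelope_eq (d : ℝ → ℝ → ℝ) (x : ℝ) :
    ∃ y ∈ s, envelope s hs d f x = f y - d x y :=
  s.exists_mem_eq_sup' hs fun y => f y - d x y

theorem le_envelope (hd : d x x = 0) (hx : x ∈ s) : f x ≤ envelope s hs d f x := by
  simpa only [hd, sub_zero] using sub_le_envelope hs f d x hx

theorem envelope_sub_le (hd : ∀ x y z, d x z ≤ d x y + d y z) (x y : ℝ) :
    envelope s hs d f y - envelope s hs d f x ≤ d x y := by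
  obtain ⟨z, hz, hyz⟩ := exists_envelope_eq hs f d y
  linarith [sub_le_envelope hs f d x hz, hd x y z]

theorem envelope_le {f} {u : ℝ → ℝ} (hfu : ∀ y ∈ s, f y ≤ u y) (hu : ∀ x y, u y - u x ≤ d x y)
    (x : ℝ) : envelope s hs d f x ≤ u x :=
  Finset.sup'_le _ _ fun y hy => by linarith [hfu y hy, hu x y]

theorem slope_le_slope_of_touching {f u : ℝ → ℝ} {a y b : ℝ} (hay : a < y) (hyb : y < b)
    (hf : slope f a y ≤ slope f y b) (ha : u y - u a ≤ f y - f a) (hb : f b - f y ≤ u b - u y) :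
    slope u a y ≤ slope u y b := by
  simp only [slope_def_field] at *
  calc (u y - u a) / (y - a) ≤ (f y - f a) / (y - a) := by gcongr
    _ ≤ (f b - f y) / (b - y) := hf
    _ ≤ (u b - u y) / (b - y) := by gcongr

theorem slope_envelope_callDist_le {R : ℝ → ℝ} (hR : ConvexOn ℝ Set.univ R) {ε : ℝ} (hε : 0 ≤ ε)
    {a y b : ℝ} (ha : a ∈ s) (hb : b ∈ s) (hay : a < y) (hyb : y < b)
    (hgap : ∀ z ∈ s, z ≤ a ∨ z = y ∨ b ≤ z) {f} (hf : slope f a y ≤ slope f y b) :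
    slope (envelope s hs (callDist R ε) f) a y ≤ slope (envelope s hs (callDist R ε) f) y b := by
  have hshift : ∀ δ, slope (fun x => R (x + δ)) a y ≤ slope (fun x => R (x + δ)) y b :=
    fun δ => slope_le_slope_of_convexOn (hR.translate_left δ) hay hyb
  obtain ⟨z, hz, hyz⟩ := exists_envelope_eq hs f (callDist R ε) y
  have haz := sub_le_envelope hs f (callDist R ε) a hz
  have hbz := sub_le_envelope hs f (callDist R ε) b hz
  rcases hgap z hz with hza | rfl | hbz'
  · rw [callDist_eq_of_ge hR hε (by linarith)] at haz hbz hyz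
    refine slope_le_slope_of_touching hay hyb (hshift (-ε)) ?_ ?_ <;>
      simp only [← sub_eq_add_neg] <;> linarith
  · rw [callDist_self, sub_zero] at hyz
    refine slope_le_slope_of_touching hay hyb hf ?_ ?_
    · linarith [le_envelope hs f (callDist_self R ε a) ha]
    · linarith [le_envelope hs f (callDist_self R ε b) hb]
  · rw [callDist_eq_of_le hR hε (by linarith)] at haz hbz hyz
    refine slope_le_slope_of_touching hay hyb (hshift ε) ?_ ?_ <;> linarith

end Envelope

section MinimalCalls

/-- The smallest increasing sequence of functions on `s` that starts at `lowerCall` and whose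
`n`-th term, which belongs to the maturity `n + 1`, is nonexpansive for the `callDist` of that
maturity. -/
noncomputable def minCall (R : ℕ → ℝ → ℝ) (ε S₀ : ℝ) (s : Finset ℝ) (hs : s.Nonempty) :
    ℕ → ℝ → ℝ
  | 0 => lowerCall (R 1) ε S₀
  | n + 1 => envelope s hs (callDist (R (n + 2)) ε) (minCall R ε S₀ s hs n)

variable {R : ℕ → ℝ → ℝ} {ε S₀ : ℝ} {s : Finset ℝ} (hs : s.Nonempty)

theorem minCall_le_minCall_succ (n : ℕ) {x : ℝ} (hx : x ∈ s) :
    minCall R ε S₀ s hs n x ≤ minCall R ε S₀ s hs (n + 1) x :=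
  le_envelope hs _ (callDist_self _ _ _) hx

theorem lowerCall_le_minCall (n : ℕ) {x : ℝ} (hx : x ∈ s) :
    lowerCall (R 1) ε S₀ x ≤ minCall R ε S₀ s hs n x :=
  monotone_nat_of_le_succ (f := fun n => minCall R ε S₀ s hs n x)
    (fun n => minCall_le_minCall_succ hs n hx) n.zero_le

theorem minCall_sub_le_callDist (n : ℕ) (x y : ℝ) :
    minCall R ε S₀ s hs n y - minCall R ε S₀ s hs n x ≤ callDist (R (n + 1)) ε x y := by
  cases n with
  | zero => exact lowerCall_sub_le_callDist _ _ _ x y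
  | succ n => exact envelope_sub_le hs _ (callDist_triangle _ _) x y

theorem exists_minCall_eq_path (n : ℕ) (x : ℝ) : ∃ k : ℕ → ℝ, k (n + 1) = x ∧
    minCall R ε S₀ s hs n x = lowerCall (R 1) ε S₀ (k 1) -
      ∑ i ∈ Finset.range n, callDist (R (i + 2)) ε (k (i + 2)) (k (i + 1)) := by
  induction n generalizing x with
  | zero => exact ⟨fun _ => x, rfl, (sub_zero _).symm⟩
  | succ n ih =>
    obtain ⟨y, -, hy⟩ :=
      exists_envelope_eq hs (minCall R ε S₀ s hs n) (callDist (R (n + 2)) ε) x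
    obtain ⟨k, rfl, hk⟩ := ih y
    have hupdate : ∀ i ≤ n, Function.update k (n + 2) x (i + 1) = k (i + 1) :=
      fun i hi => Function.update_of_ne (by omega) _ _
    refine ⟨Function.update k (n + 2) x, Function.update_self _ _ _, hy.trans ?_⟩
    rw [Finset.sum_range_succ, Function.update_self, hupdate n le_rfl, hupdate 0 n.zero_le, hk,
      ← sub_sub]
    congr 2
    refine Finset.sum_congr rfl fun i hi => ?_
    rw [Finset.mem_range] at hi
    rw [hupdate i hi.le, hupdate (i + 1) hi]

theorem minCall_le_upperCall {T : ℕ} (hε : 0 ≤ ε)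
    (hR : ∀ t ∈ Set.Icc 1 T, ConvexOn ℝ Set.univ (R t)) (hP : PathConditions T R ε S₀)
    (h₁ : ∀ x, lowerCall (R 1) ε S₀ x ≤ upperCall (R 1) ε S₀ x) {n : ℕ} (hn : n + 1 ≤ T) (x : ℝ) :
    minCall R ε S₀ s hs n x ≤ upperCall (R (n + 1)) ε S₀ x := by
  cases n with
  | zero => exact h₁ x
  | succ n =>
    refine envelope_le hs (fun y _ => ?_) (upperCall_sub_le_callDist _ _ _) x
    obtain ⟨k, rfl, hk⟩ := exists_minCall_eq_path (R := R) (ε := ε) (S₀ := S₀) hs n y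
    rw [hk, sub_le_iff_le_add]
    exact (pathConditions_iff hε hR).1 hP n hn k

theorem slope_minCall_le (hε : 0 ≤ ε) {n : ℕ}
    (hR : ∀ t ∈ Set.Icc 1 (n + 1), ConvexOn ℝ Set.univ (R t)) {a y b : ℝ} (ha : a ∈ s)
    (hb : b ∈ s) (hay : a < y) (hyb : y < b) (hgap : ∀ z ∈ s, z ≤ a ∨ z = y ∨ b ≤ z) :
    slope (minCall R ε S₀ s hs n) a y ≤ slope (minCall R ε S₀ s hs n) y b := by
  induction n with
  | zero =>
    exact slope_le_slope_of_convexOn (convexOn_lowerCall (hR 1 ⟨le_rfl, le_rfl⟩) ε S₀) hay hyb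
  | succ n ih =>
    exact slope_envelope_callDist_le hs (hR (n + 2) ⟨by omega, le_rfl⟩) hε ha hb hay hyb hgap
      (ih fun t ht => hR t ⟨ht.1, ht.2.trans (Nat.le_succ _)⟩)

end MinimalCalls

theorem IsCoupling.sum_mul_fst {α β : Type*} [Fintype α] [Fintype β] {p : α → ℝ} {q : β → ℝ}
    {J : α → β → ℝ} (hJ : IsCoupling p q J) (f : α → ℝ) :
    ∑ e : α × β, J e.1 e.2 * f e.1 = ∑ a, p a * f a := by
  simp only [Fintype.sum_prod_type, ← Finset.sum_mul, hJ.sum_right]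

theorem IsCoupling.sum_mul_snd {α β : Type*} [Fintype α] [Fintype β] {p : α → ℝ} {q : β → ℝ}
    {J : α → β → ℝ} (hJ : IsCoupling p q J) (f : β → ℝ) :
    ∑ e : α × β, J e.1 e.2 * f e.2 = ∑ b, q b * f b := by
  simp only [Fintype.sum_prod_type_right, ← Finset.sum_mul, hJ.sum_left]

theorem IsCoupling.mem_stdSimplex {α β : Type*} [Fintype α] [Fintype β] {p : α → ℝ} {q : β → ℝ}
    {J : α → β → ℝ} (hJ : IsCoupling p q J) (hq : ∑ b, q b = 1) :
    (fun e : α × β => J e.1 e.2) ∈ stdSimplex ℝ (α × β) :=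
  ⟨fun e => hJ.nonneg e.1 e.2, by simpa [hq] using hJ.sum_mul_snd 1⟩

theorem IsCoupling.convexOrderLE_snd {α β α' β' : Type*} [Fintype α] [Fintype β] [Fintype α']
    [Fintype β'] {p : α → ℝ} {q : β → ℝ} {J : α → β → ℝ} {p' : α' → ℝ} {q' : β' → ℝ}
    {J' : α' → β' → ℝ} {z : β → ℝ} {z' : β' → ℝ} (hJ : IsCoupling p q J)
    (hJ' : IsCoupling p' q' J') (h : ConvexOrderLE q z q' z') :
    ConvexOrderLE (fun e : α × β => J e.1 e.2) (fun e => z e.2)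
      (fun e : α' × β' => J' e.1 e.2) fun e => z' e.2 := fun φ hφ => by
  rw [hJ.sum_mul_snd fun b => φ (z b), hJ'.sum_mul_snd fun b => φ (z' b)]
  exact h φ hφ

section FiniteSupport

variable {μ : Measure ℝ} {F : Finset ℝ}

theorem integral_eq_sum_of_compl_null [IsFiniteMeasure μ] (hF : μ (F : Set ℝ)ᶜ = 0) (f : ℝ → ℝ) :
    ∫ y, f y ∂μ = ∑ x : F, μ.real {(x : ℝ)} * f x := by
  have hrestrict : μ.restrict F = μ := Measure.restrict_eq_self_of_ae_mem (s := (F : Set ℝ)) hF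
  rw [← hrestrict, setIntegral_finset F .finset, hrestrict, ← Finset.sum_coe_sort F]
  simp only [smul_eq_mul]

theorem sum_measureReal_singleton_filter [IsFiniteMeasure μ] (hF : μ (F : Set ℝ)ᶜ = 0)
    {s : Set ℝ} (hs : MeasurableSet s) [DecidablePred fun x : F => x.1 ∈ s] :
    ∑ x : F with x.1 ∈ s, μ.real {(x : ℝ)} = μ.real s := by
  rw [← integral_indicator_one hs, integral_eq_sum_of_compl_null hF, Finset.sum_filter]
  simp [Set.indicator_apply]

theorem measureReal_singleton_mem_stdSimplex [IsProbabilityMeasure μ] (hF : μ (F : Set ℝ)ᶜ = 0) :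
    (fun x : F => μ.real {(x : ℝ)}) ∈ stdSimplex ℝ F :=
  ⟨fun _ => measureReal_nonneg, by simpa using (integral_eq_sum_of_compl_null hF 1).symm⟩

end FiniteSupport

section GridCoupling

variable {μ : Measure ℝ} [IsProbabilityMeasure μ] {ε : ℝ} {c : ℝ → ℝ}

theorem slope_le_measureReal_Iio_sub_one (hμ : Integrable (fun y => y) μ) (hε : 0 ≤ ε)
    (hc : ∀ x y, c y - c x ≤ callDist (callFunction μ) ε x y) {a b : ℝ} (hab : a < b) :
    slope c a b ≤ μ.real (Set.Iio (b + ε)) - 1 := by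
  refine le_trans ?_ (slope_callFunction_le_measureReal_Iio_sub_one hμ (add_lt_add_left hab ε))
  have hle := hc a b
  rw [callDist_eq_of_le (convexOn_callFunction hμ) hε hab.le] at hle
  rw [slope_def_field, slope_def_field, add_sub_add_right_eq_sub]
  gcongr

theorem measureReal_Iic_sub_one_le_slope (hμ : Integrable (fun y => y) μ) (hε : 0 ≤ ε)
    (hc : ∀ x y, c y - c x ≤ callDist (callFunction μ) ε x y) {a b : ℝ} (hab : a < b) :
    μ.real (Set.Iic (a - ε)) - 1 ≤ slope c a b := by
  refine (measureReal_Iic_sub_one_le_slope_callFunction hμ (sub_lt_sub_right hab ε)).trans ?_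
  have hge := hc b a
  rw [callDist_eq_of_ge (convexOn_callFunction hμ) hε hab.le] at hge
  rw [slope_def_field, slope_def_field, sub_sub_sub_cancel_right]
  gcongr ?_ / _
  linarith

variable {g : ℕ → ℝ} {N : ℕ}

theorem gridMass_mem_stdSimplex (hfirst : slope c (g 0) (g 1) = -1)
    (hlast : slope c (g N) (g (N + 1)) = 0)
    (hmono : ∀ j < N, slope c (g j) (g (j + 1)) ≤ slope c (g (j + 1)) (g (j + 2))) :
    (fun j : Fin N => gridMass g c j) ∈ stdSimplex ℝ (Fin N) := by
  refine ⟨fun j => sub_nonneg.2 (hmono j j.2), ?_⟩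
  rw [Fin.sum_univ_eq_sum_range (gridMass g c), sum_range_gridMass, hfirst, hlast]
  norm_num

theorem sum_le_gridMass (hfirst : slope c (g 0) (g 1) = -1) (j : Fin N) :
    ∑ i : Fin N with i ≤ j, gridMass g c i = slope c (g (j + 1)) (g (j + 2)) + 1 := by
  have hrange : ∑ i : Fin N with i ≤ j, gridMass g c i =
      ∑ i ∈ Finset.range (j + 1), gridMass g c i := by
    rw [Nat.range_succ_eq_Iic, ← Fin.map_valEmbedding_Iic, Finset.sum_map]
    exact Finset.sum_congr (by ext; simp) fun _ _ => rfl
  rw [hrange, sum_range_gridMass, hfirst, sub_neg_eq_add]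

theorem sum_lt_gridMass (hfirst : slope c (g 0) (g 1) = -1) (j : Fin N) :
    ∑ i : Fin N with i < j, gridMass g c i = slope c (g j) (g (j + 1)) + 1 := by
  have hsum := sum_lt_add_self (fun i : Fin N => gridMass g c i) j
  rw [sum_le_gridMass hfirst, gridMass] at hsum
  linarith

theorem exists_coupling_gridMass (hμ : Integrable (fun y => y) μ) {F : Finset ℝ}
    (hF : μ (F : Set ℝ)ᶜ = 0) (hg : StrictMono g) (hε : 0 ≤ ε)
    (hadd : ∀ x ∈ F, ∃ i, g i = x + ε) (hsub : ∀ x ∈ F, ∃ i, g i = x - ε)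
    (hc : ∀ x y, c y - c x ≤ callDist (callFunction μ) ε x y)
    (hfirst : slope c (g 0) (g 1) = -1) (hlast : slope c (g N) (g (N + 1)) = 0)
    (hmono : ∀ j < N, slope c (g j) (g (j + 1)) ≤ slope c (g (j + 1)) (g (j + 2))) :
    ∃ J : F → Fin N → ℝ,
      IsCoupling (fun x : F => μ.real {(x : ℝ)}) (fun j : Fin N => gridMass g c j) J ∧
      ∀ x j, J x j ≠ 0 → |(x : ℝ) - g (j + 1)| ≤ ε := by
  obtain ⟨J, hJ, hJ_ne⟩ := exists_monotone_coupling (measureReal_singleton_mem_stdSimplex hF)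
    (gridMass_mem_stdSimplex hfirst hlast hmono)
  refine ⟨J, hJ, fun x j hxj => ?_⟩
  obtain ⟨hlt_le, hlt_le'⟩ := hJ_ne x j hxj
  have hIio : ∑ y : F with y < x, μ.real {(y : ℝ)} = μ.real (Set.Iio (x : ℝ)) :=
    sum_measureReal_singleton_filter hF measurableSet_Iio
  have hIic : ∑ y : F with y ≤ x, μ.real {(y : ℝ)} = μ.real (Set.Iic (x : ℝ)) :=
    sum_measureReal_singleton_filter hF measurableSet_Iic
  rw [hIio, sum_le_gridMass hfirst] at hlt_le
  rw [hIic, sum_lt_gridMass hfirst] at hlt_le'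
  obtain ⟨i, hi⟩ := hadd x x.2
  obtain ⟨m, hm⟩ := hsub x x.2
  have hx_lt : (x : ℝ) < g (j + 2) + ε := by
    by_contra! hle
    have := slope_le_measureReal_Iio_sub_one hμ hε hc (hg (j + 1 : ℕ).lt_succ_self)
    linarith [measureReal_mono (μ := μ) (Set.Iio_subset_Iio hle)]
  have hlt_x : g j - ε < x := by
    by_contra! hle
    have := measureReal_Iic_sub_one_le_slope hμ hε hc (hg (j : ℕ).lt_succ_self)
    linarith [measureReal_mono (μ := μ) (Set.Iic_subset_Iic.2 hle)]
  have hmj : m < j + 2 := hg.lt_iff_lt.1 (by linarith)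
  have hji : (j : ℕ) < i := hg.lt_iff_lt.1 (by linarith)
  have hle_gm := hg.monotone (Nat.le_of_lt_succ hmj)
  have hgi_le := hg.monotone (Nat.succ_le_of_lt hji)
  exact abs_le.2 ⟨by linarith, by linarith⟩

end GridCoupling

namespace SimplifyingAssumptions

variable {D : MarketData} {ε S₀ : ℝ} {R : ℕ → ℝ → ℝ} {μ : ℕ → Measure ℝ} {t : ℕ}

theorem lowerCall_le_upperCall (hA : SimplifyingAssumptions D ε S₀ R μ)
    (ht : t ∈ Set.Icc 1 D.T) (x : ℝ) : lowerCall (R t) ε S₀ x ≤ upperCall (R t) ε S₀ x := by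
  have := hA.isProb t ht.1 ht.2
  have hX : Integrable (fun y => y) (μ t) := hA.integrable ht
  have hmean := hA.mean_mem t ht.1 ht.2
  -- The translate of `μ t` with mean `S₀` is at distance at most `ε`.
  let Y : ℝ → ℝ := fun y => y + (S₀ - ∫ y, y ∂μ t)
  have hY : Integrable Y (μ t) := hX.add (integrable_const _)
  have hY_mean : ∫ y, Y y ∂μ t = S₀ := by simp [Y, integral_add hX]
  have hXY : ∀ᵐ y ∂μ t, |y - Y y| ≤ ε := .of_forall fun y => by
    rw [abs_le]
    constructor <;> linarith [hmean.1, hmean.2]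
  have hlower := lowerCall_le_callFunction_map hX hY hXY (hA.ae_ge ht) x
  have hupper := callFunction_map_le_upperCall hX hY hXY (hA.ae_ge ht) x
  rw [Measure.map_id', ← hA.R_eq t ht.1 ht.2, hY_mean] at hlower hupper
  exact hlower.trans hupper

theorem eq_add_of_ae_le (hA : SimplifyingAssumptions D ε S₀ R μ) (ht : t ∈ Set.Icc 1 D.T) {x : ℝ}
    (hx : ∀ᵐ y ∂μ t, x ≤ y) : R t x = R t ε + (ε - x) := by
  have := hA.isProb t ht.1 ht.2
  rw [hA.R_eq t ht.1 ht.2, callFunction_eq_mean_sub (hA.integrable ht) hx,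
    callFunction_eq_mean_sub (hA.integrable ht) (hA.ae_ge ht)]
  ring

theorem exists_finset_compl_null (hA : SimplifyingAssumptions D ε S₀ R μ) :
    ∃ F : Finset ℝ, S₀ ∈ F ∧ ∀ t ∈ Set.Icc 1 D.T, μ t (F : Set ℝ)ᶜ = 0 := by
  choose! G hG using hA.finite_support
  refine ⟨insert S₀ ((Finset.Icc 1 D.T).biUnion G), Finset.mem_insert_self _ _, fun t ht =>
    measure_mono_null (Set.compl_subset_compl.2 (Finset.coe_subset.2 ?_)) (hG t ht.1 ht.2).2⟩
  exact (Finset.subset_biUnion_of_mem G (Finset.mem_Icc.2 ht)).trans (Finset.subset_insert _ _)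

end SimplifyingAssumptions

/-- A grid `g` of prices whose interior `g 1, …, g N` contains the initial price `S₀` and all
points `x ± ε`, `x ∈ F`, at which the functions `R (· ± ε)` of laws supported on `F` have kinks. -/
structure IsPriceGrid (F : Finset ℝ) (ε S₀ : ℝ) (g : ℕ → ℝ) (N : ℕ) : Prop where
  strictMono : StrictMono g
  exists_eq_add : ∀ x ∈ F, ∃ i < N, g (i + 1) = x + ε
  exists_eq_sub : ∀ x ∈ F, ∃ i < N, g (i + 1) = x - ε
  exists_eq_initial : ∃ i < N, g (i + 1) = S₀

theorem exists_isPriceGrid (F : Finset ℝ) (ε S₀ : ℝ) : ∃ g N, IsPriceGrid F ε S₀ g N := by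
  obtain ⟨g, N, hg, hs⟩ :=
    exists_strictMono_of_finset (insert S₀ (F.image (· + ε) ∪ F.image (· - ε)))
  exact ⟨g, N, hg, fun x hx => hs _ (by grind), fun x hx => hs _ (by grind), hs _ (by grind)⟩

/-- The call prices of the consistent price system at maturity `n + 1`, as a function of the strike,
in the construction of a model: `minCall` for the strikes `g 0, …, g (N + 1)`. -/
noncomputable def gridCall (R : ℕ → ℝ → ℝ) (ε S₀ : ℝ) (g : ℕ → ℝ) (N n : ℕ) : ℝ → ℝ :=
  minCall R ε S₀ ((Finset.range (N + 2)).image g) (Finset.nonempty_range_add_one.image g) n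

section GridCall

variable {D : MarketData} {ε S₀ : ℝ} {R : ℕ → ℝ → ℝ} {μ : ℕ → Measure ℝ} {F : Finset ℝ}
  {g : ℕ → ℝ} {N n : ℕ}

theorem mem_image_range_grid (g : ℕ → ℝ) {i : ℕ} (hi : i ≤ N + 1) :
    g i ∈ (Finset.range (N + 2)).image g :=
  Finset.mem_image_of_mem g (Finset.mem_range.2 (Nat.lt_succ_of_le hi))

theorem gridCall_mono (n : ℕ) {i : ℕ} (hi : i ≤ N + 1) :
    gridCall R ε S₀ g N n (g i) ≤ gridCall R ε S₀ g N (n + 1) (g i) :=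
  minCall_le_minCall_succ _ n (mem_image_range_grid g hi)

theorem gridCall_mem_Icc (hε : 0 ≤ ε) (hA : SimplifyingAssumptions D ε S₀ R μ)
    (hP : PathConditions D.T R ε S₀) (hn : n + 1 ≤ D.T) {i : ℕ} (hi : i ≤ N + 1) :
    gridCall R ε S₀ g N n (g i) ∈
      Set.Icc (lowerCall (R 1) ε S₀ (g i)) (upperCall (R (n + 1)) ε S₀ (g i)) :=
  ⟨lowerCall_le_minCall _ n (mem_image_range_grid g hi), minCall_le_upperCall _ hε
    (fun _ ht => hA.convexOn ht) hP (hA.lowerCall_le_upperCall ⟨le_rfl, D.one_le_T⟩) hn (g i)⟩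

theorem gridCall_eq_sub (hε : 0 ≤ ε) (hA : SimplifyingAssumptions D ε S₀ R μ)
    (hP : PathConditions D.T R ε S₀) (hF : ∀ t ∈ Set.Icc 1 D.T, μ t (F : Set ℝ)ᶜ = 0)
    (hg : IsPriceGrid F ε S₀ g N) (hn : n + 1 ≤ D.T) {i : ℕ} (hi : i ≤ 1) :
    gridCall R ε S₀ g N n (g i) = S₀ - g i := by
  have hmem := gridCall_mem_Icc (g := g) (N := N) hε hA hP hn (hi.trans (by omega))
  have hgF : ∀ x ∈ F, g i + ε ≤ x := fun x hx => by
    obtain ⟨m, -, hm⟩ := hg.exists_eq_sub x hx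
    linarith [hg.strictMono.monotone (show i ≤ m + 1 by omega)]
  have hR : ∀ t ∈ Set.Icc 1 D.T, ∀ x ≤ g i + ε, R t x = R t ε + (ε - x) := fun t ht x hx =>
    hA.eq_add_of_ae_le ht (measure_mono_null (fun y hy hyF => hy (hx.trans (hgF y hyF))) (hF t ht))
  have hlower : R 1 (g i - ε) + (S₀ - 2 * ε - R 1 ε) ≤ lowerCall (R 1) ε S₀ (g i) :=
    le_max_right _ _
  have hupper : upperCall (R (n + 1)) ε S₀ (g i) ≤ R (n + 1) (g i + ε) + (S₀ - R (n + 1) ε) :=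
    min_le_right _ _
  rw [hR 1 ⟨le_rfl, D.one_le_T⟩ _ (by linarith)] at hlower
  rw [hR (n + 1) ⟨by omega, hn⟩ _ le_rfl] at hupper
  linarith [hmem.1, hmem.2]

theorem gridCall_eq_zero (hε : 0 ≤ ε) (hA : SimplifyingAssumptions D ε S₀ R μ)
    (hP : PathConditions D.T R ε S₀) (hF : ∀ t ∈ Set.Icc 1 D.T, μ t (F : Set ℝ)ᶜ = 0)
    (hg : IsPriceGrid F ε S₀ g N) (hn : n + 1 ≤ D.T) {i : ℕ} (hi : i ∈ Set.Icc N (N + 1)) :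
    gridCall R ε S₀ g N n (g i) = 0 := by
  have hmem := gridCall_mem_Icc (g := g) (N := N) hε hA hP hn hi.2
  have hFg : ∀ x ∈ F, x ≤ g i - ε := fun x hx => by
    obtain ⟨m, hmN, hm⟩ := hg.exists_eq_add x hx
    linarith [hg.strictMono.monotone (show m + 1 ≤ i from hmN.trans_le hi.1)]
  have hlower : 0 ≤ lowerCall (R 1) ε S₀ (g i) := by
    refine le_trans ?_ (le_max_left _ _)
    exact hA.R_eq 1 le_rfl D.one_le_T ▸ callFunction_nonneg _ _
  have hupper : upperCall (R (n + 1)) ε S₀ (g i) ≤ 0 := by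
    refine (min_le_left _ _).trans_eq ?_
    rw [hA.R_eq (n + 1) (by omega) hn]
    exact callFunction_eq_zero
      (measure_mono_null (fun y hy hyF => hy (hFg y hyF)) (hF _ ⟨by omega, hn⟩))
  linarith [hmem.1, hmem.2]

theorem slope_gridCall_zero (hε : 0 ≤ ε) (hA : SimplifyingAssumptions D ε S₀ R μ)
    (hP : PathConditions D.T R ε S₀) (hF : ∀ t ∈ Set.Icc 1 D.T, μ t (F : Set ℝ)ᶜ = 0)
    (hg : IsPriceGrid F ε S₀ g N) (hn : n + 1 ≤ D.T) :
    slope (gridCall R ε S₀ g N n) (g 0) (g 1) = -1 := by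
  rw [slope_def_field, gridCall_eq_sub hε hA hP hF hg hn zero_le_one,
    gridCall_eq_sub hε hA hP hF hg hn le_rfl, sub_sub_sub_cancel_left, ← neg_sub (g 1),
    neg_div, div_self (sub_pos.2 (hg.strictMono zero_lt_one)).ne']

theorem slope_gridCall_last (hε : 0 ≤ ε) (hA : SimplifyingAssumptions D ε S₀ R μ)
    (hP : PathConditions D.T R ε S₀) (hF : ∀ t ∈ Set.Icc 1 D.T, μ t (F : Set ℝ)ᶜ = 0)
    (hg : IsPriceGrid F ε S₀ g N) (hn : n + 1 ≤ D.T) :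
    slope (gridCall R ε S₀ g N n) (g N) (g (N + 1)) = 0 := by
  rw [slope_def_field, gridCall_eq_zero hε hA hP hF hg hn (by simp),
    gridCall_eq_zero hε hA hP hF hg hn (by simp), sub_zero, zero_div]

theorem slope_gridCall_le (hε : 0 ≤ ε) (hA : SimplifyingAssumptions D ε S₀ R μ)
    (hg : StrictMono g) (hn : n + 1 ≤ D.T) {j : ℕ} (hj : j < N) :
    slope (gridCall R ε S₀ g N n) (g j) (g (j + 1)) ≤
      slope (gridCall R ε S₀ g N n) (g (j + 1)) (g (j + 2)) := by
  refine slope_minCall_le _ hε (fun t ht => hA.convexOn ⟨ht.1, ht.2.trans hn⟩)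
    (mem_image_range_grid g (by omega)) (mem_image_range_grid g (by omega)) (hg (by omega))
    (hg (by omega)) fun z hz => ?_
  obtain ⟨i, -, rfl⟩ := Finset.mem_image.1 hz
  simp only [hg.le_iff_le, hg.injective.eq_iff]
  omega

theorem gridMass_gridCall_mem_stdSimplex (hε : 0 ≤ ε) (hA : SimplifyingAssumptions D ε S₀ R μ)
    (hP : PathConditions D.T R ε S₀) (hF : ∀ t ∈ Set.Icc 1 D.T, μ t (F : Set ℝ)ᶜ = 0)
    (hg : IsPriceGrid F ε S₀ g N) (hn : n + 1 ≤ D.T) :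
    (fun j : Fin N => gridMass g (gridCall R ε S₀ g N n) j) ∈ stdSimplex ℝ (Fin N) :=
  gridMass_mem_stdSimplex (slope_gridCall_zero hε hA hP hF hg hn)
    (slope_gridCall_last hε hA hP hF hg hn) fun _ => slope_gridCall_le hε hA hg.strictMono hn

theorem exists_coupling_gridCall (hε : 0 ≤ ε) (hA : SimplifyingAssumptions D ε S₀ R μ)
    (hP : PathConditions D.T R ε S₀) (hF : ∀ t ∈ Set.Icc 1 D.T, μ t (F : Set ℝ)ᶜ = 0)
    (hg : IsPriceGrid F ε S₀ g N) (hn : n + 1 ≤ D.T) :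
    ∃ J : F → Fin N → ℝ, IsCoupling (fun x : F => (μ (n + 1)).real {(x : ℝ)})
      (fun j : Fin N => gridMass g (gridCall R ε S₀ g N n) j) J ∧
      ∀ x j, J x j ≠ 0 → |(x : ℝ) - g (j + 1)| ≤ ε := by
  have hmem : n + 1 ∈ Set.Icc 1 D.T := ⟨Nat.succ_pos n, hn⟩
  have := hA.isProb _ hmem.1 hmem.2
  refine exists_coupling_gridMass (hA.integrable hmem) (hF _ hmem) hg.strictMono hε
    (fun x hx => (hg.exists_eq_add x hx).imp' _ fun i hi => hi.2)
    (fun x hx => (hg.exists_eq_sub x hx).imp' _ fun i hi => hi.2) ?_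
    (slope_gridCall_zero hε hA hP hF hg hn) (slope_gridCall_last hε hA hP hF hg hn)
    fun _ => slope_gridCall_le hε hA hg.strictMono hn
  rw [← hA.R_eq _ hmem.1 hmem.2]
  exact minCall_sub_le_callDist _ n

theorem sum_gridMass_gridCall_mul_grid (hε : 0 ≤ ε) (hA : SimplifyingAssumptions D ε S₀ R μ)
    (hP : PathConditions D.T R ε S₀) (hF : ∀ t ∈ Set.Icc 1 D.T, μ t (F : Set ℝ)ᶜ = 0)
    (hg : IsPriceGrid F ε S₀ g N) (hn : n + 1 ≤ D.T) :
    ∑ j : Fin N, gridMass g (gridCall R ε S₀ g N n) j * g (j + 1) = S₀ := by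
  have hsum := sum_range_gridMass_mul_sub g (gridCall R ε S₀ g N n) 0 N
  rw [slope_gridCall_zero hε hA hP hF hg hn, slope_gridCall_last hε hA hP hF hg hn,
    gridCall_eq_sub hε hA hP hF hg hn zero_le_one,
    gridCall_eq_zero hε hA hP hF hg hn (by simp)] at hsum
  simp only [zero_sub, mul_neg, Finset.sum_neg_distrib] at hsum
  rw [Fin.sum_univ_eq_sum_range fun j => gridMass g (gridCall R ε S₀ g N n) j * g (j + 1)]
  linarith

theorem convexOrderLE_gridCall (hε : 0 ≤ ε) (hA : SimplifyingAssumptions D ε S₀ R μ)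
    (hP : PathConditions D.T R ε S₀) (hF : ∀ t ∈ Set.Icc 1 D.T, μ t (F : Set ℝ)ᶜ = 0)
    (hg : IsPriceGrid F ε S₀ g N) (hn : n + 2 ≤ D.T) :
    ConvexOrderLE (fun j : Fin N => gridMass g (gridCall R ε S₀ g N n) j) (fun j => g (j + 1))
      (fun j : Fin N => gridMass g (gridCall R ε S₀ g N (n + 1)) j) fun j => g (j + 1) := by
  have hcall : ∀ m, m + 1 ≤ D.T → ∀ i ≤ N, ∑ j : Fin N,
      gridMass g (gridCall R ε S₀ g N m) j * max (g (j + 1) - g i) 0 =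
        gridCall R ε S₀ g N m (g i) := by
    intro m hm i hi
    rw [Fin.sum_univ_eq_sum_range fun j =>
      gridMass g (gridCall R ε S₀ g N m) j * max (g (j + 1) - g i) 0]
    exact sum_range_gridMass_mul_call hg.strictMono hi
      (gridCall_eq_zero hε hA hP hF hg hm (by simp)) (gridCall_eq_zero hε hA hP hF hg hm (by simp))
  refine .of_calls_le (ι := fun j : Fin N => j + 1) (κ := fun j : Fin N => j + 1) hg.strictMono
    (gridMass_gridCall_mem_stdSimplex hε hA hP hF hg (Nat.le_of_succ_le hn)).2
    (gridMass_gridCall_mem_stdSimplex hε hA hP hF hg hn).2 (fun j => j.2) (fun j => j.2) ?_ ?_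
  · rw [sum_gridMass_gridCall_mul_grid hε hA hP hF hg (Nat.le_of_succ_le hn),
      sum_gridMass_gridCall_mul_grid hε hA hP hF hg hn]
  · intro j hj
    rw [hcall n (Nat.le_of_succ_le hn) _ hj, hcall (n + 1) hn _ hj]
    exact gridCall_mono n (by omega)

end GridCall

section JointLaw

/-- Weights `w 0, …, w T` on a finite state space: in state `e`, the discounted reference price is
`x e` and the discounted consistent price system is `z e`. These are the one-dimensional
distributions of an `ε`-consistent model for which the reference price at time `t` has law `μ t`. -/
structure IsJointLaw {E : Type*} [Fintype E] (T : ℕ) (ε S₀ : ℝ) (μ : ℕ → Measure ℝ) (x z : E → ℝ)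
    (w : ℕ → E → ℝ) : Prop where
  mem_stdSimplex : ∀ t ≤ T, w t ∈ stdSimplex ℝ E
  initial : ∀ e, w 0 e ≠ 0 → x e = S₀ ∧ z e = S₀
  sum_eq_integral : ∀ t ∈ Set.Icc 1 T, ∀ φ : ℝ → ℝ, ∑ e, w t e * φ (x e) = ∫ y, φ y ∂μ t
  dist_le : ∀ t ∈ Set.Icc 1 T, ∀ e, w t e ≠ 0 → |x e - z e| ≤ ε
  convexOrder : ∀ t < T, ConvexOrderLE (w t) z (w (t + 1)) z

theorem convexOrderLE_single {α β : Type*} [Fintype α] [DecidableEq α] [Fintype β] (a : α)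
    (y : α → ℝ) {q : β → ℝ} {z : β → ℝ} (hq : q ∈ stdSimplex ℝ β) (hmean : ∑ b, q b * z b = y a) :
    ConvexOrderLE (Pi.single a 1) y q z := by
  intro φ hφ
  have hjensen := hφ.map_sum_le (fun b _ => hq.1 b) hq.2 fun b _ => Set.mem_univ (z b)
  simpa [Pi.single_apply, hmean] using hjensen

theorem exists_isJointLaw {D : MarketData} {ε S₀ : ℝ} {R : ℕ → ℝ → ℝ} {μ : ℕ → Measure ℝ}
    (hε : 0 ≤ ε) (hA : SimplifyingAssumptions D ε S₀ R μ) (hP : PathConditions D.T R ε S₀) :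
    ∃ (E : Type) (_ : Fintype E) (x z : E → ℝ) (w : ℕ → E → ℝ),
      IsJointLaw D.T ε S₀ μ x z w := by
  classical
  obtain ⟨F, hS₀, hF⟩ := hA.exists_finset_compl_null
  obtain ⟨g, N, hg⟩ := exists_isPriceGrid F ε S₀
  obtain ⟨i₀, hi₀, hgi₀⟩ := hg.exists_eq_initial
  choose! J hJ hJ_dist using fun n (hn : n + 1 ≤ D.T) => exists_coupling_gridCall hε hA hP hF hg hn
  let e₀ : F × Fin N := (⟨S₀, hS₀⟩, ⟨i₀, hi₀⟩)
  let z : F × Fin N → ℝ := fun e => g (e.2 + 1)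
  let w : ℕ → F × Fin N → ℝ
    | 0 => Pi.single e₀ 1
    | n + 1 => fun e => J n e.1 e.2
  have hw_mem : ∀ t ≤ D.T, w t ∈ stdSimplex ℝ (F × Fin N) := by
    rintro (_ | n) ht
    · exact single_mem_stdSimplex ℝ e₀
    · exact (hJ n ht).mem_stdSimplex (gridMass_gridCall_mem_stdSimplex hε hA hP hF hg ht).2
  refine ⟨F × Fin N, inferInstance, fun e => e.1, z, w, hw_mem, fun e he => ?_, ?_, ?_, ?_⟩
  · obtain rfl : e = e₀ := by_contra fun hne => he (Pi.single_eq_of_ne hne 1)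
    exact ⟨rfl, hgi₀⟩
  · rintro (_ | n) ht φ
    · exact absurd ht.1 (by norm_num)
    · have := hA.isProb _ ht.1 ht.2
      exact ((hJ n ht.2).sum_mul_fst _).trans (integral_eq_sum_of_compl_null (hF _ ht) φ).symm
  · rintro (_ | n) ht e he
    · exact absurd ht.1 (by norm_num)
    · exact hJ_dist n ht.2 _ _ he
  · rintro (_ | n) ht
    · refine convexOrderLE_single e₀ z (hw_mem 1 ht) ?_
      exact ((hJ 0 ht).sum_mul_snd fun j => g (j + 1)).trans
        ((sum_gridMass_gridCall_mul_grid hε hA hP hF hg ht).trans hgi₀.symm)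
    · exact (hJ n ht.le).convexOrderLE_snd (hJ (n + 1) ht)
        (convexOrderLE_gridCall hε hA hP hF hg ht)

end JointLaw

section MartingalePaths

variable {Ω E : Type*} {X : ℕ → Ω → E} {t n : ℕ}

/-- The path of the process `X` up to time `t`. -/
def history (X : ℕ → Ω → E) (t : ℕ) (ω : Ω) : Set.Iic t → E :=
  fun k => X k ω

/-- The process on `Ω × E` that follows `X` up to time `n` and then stays at the second
coordinate. -/
def extendPath (X : ℕ → Ω → E) (n t : ℕ) (ω : Ω × E) : E :=
  if t ≤ n then X t ω.1 else ω.2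

theorem extendPath_of_le (ht : t ≤ n) (ω : Ω × E) : extendPath X n t ω = X t ω.1 :=
  if_pos ht

theorem extendPath_of_lt (ht : n < t) (ω : Ω × E) : extendPath X n t ω = ω.2 :=
  if_neg ht.not_ge

theorem history_extendPath (ht : t ≤ n) (ω : Ω × E) :
    history (extendPath X n) t ω = history X t ω.1 :=
  funext fun k => extendPath_of_le (k.2.trans ht) ω

/-- The weights on `Ω × E` under which `Ω` has weights `P` and, given `ω : Ω`, the second coordinate
has the conditional law of the second marginal of the coupling `J` at the value `ξ ω` of its first
marginal `p`. -/
noncomputable def extendWeight (P : Ω → ℝ) (ξ : Ω → E) (p : E → ℝ) (J : E → E → ℝ) (ω : Ω × E) :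
    ℝ :=
  P ω.1 * (J (ξ ω.1) ω.2 / p (ξ ω.1))

theorem sum_extendWeight_mul_sub [Fintype E] {z : E → ℝ} {w : ℕ → E → ℝ} {P : Ω → ℝ}
    {J : E → E → ℝ} (hJ_mart : ∀ a, ∑ b, J a b * (z b - z a) = 0) (ω : Ω) :
    ∑ e, extendWeight P (X n) (w n) J (ω, e) * (z e - z (X n ω)) = 0 := by
  simp only [extendWeight, mul_assoc, div_mul_eq_mul_div, ← Finset.mul_sum, ← Finset.sum_div,
    hJ_mart, zero_div, mul_zero]

variable [Fintype Ω] [Fintype E]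

/-- Weights `P` on a finite sample space under which the process `z ∘ X` is a martingale in the
filtration generated by `X` and, for all `t ≤ T`, `X t` has the law with weights `w t`. -/
structure IsMartingalePaths (T : ℕ) (z : E → ℝ) (w : ℕ → E → ℝ) (P : Ω → ℝ) (X : ℕ → Ω → E) :
    Prop where
  mem_stdSimplex : P ∈ stdSimplex ℝ Ω
  marginal : ∀ t ≤ T, ∀ f : E → ℝ, ∑ ω, P ω * f (X t ω) = ∑ e, w t e * f e
  sum_mul_increment : ∀ t, ∀ φ : Ω → ℝ, φ.FactorsThrough (history X t) →
    ∑ ω, P ω * (φ ω * (z (X (t + 1) ω) - z (X t ω))) = 0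

theorem IsMartingalePaths.weight_ne_zero {T : ℕ} {z : E → ℝ} {w : ℕ → E → ℝ} {P : Ω → ℝ}
    (hX : IsMartingalePaths T z w P X) (ht : t ≤ T) {ω : Ω} (hω : P ω ≠ 0) : w t (X t ω) ≠ 0 := by
  classical
  intro hw
  have hsum := hX.marginal t ht (Pi.single (X t ω) 1)
  rw [Fintype.sum_eq_single (X t ω) fun e he => by simp [he], hw, zero_mul,
    Fintype.sum_eq_zero_iff_of_nonneg fun ω' =>
      mul_nonneg (hX.mem_stdSimplex.1 ω')
        ((Pi.single_nonneg.2 zero_le_one : (0 : E → ℝ) ≤ Pi.single (X t ω) 1) _)] at hsum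
  exact hω (by simpa using congrFun hsum ω)

section Extension

variable {z : E → ℝ} {w : ℕ → E → ℝ} {P : Ω → ℝ} {J : E → E → ℝ}

theorem IsCoupling.mul_div_self {p q : E → ℝ} (hJ : IsCoupling p q J) (a b : E) :
    p a * (J a b / p a) = J a b := by
  refine mul_div_cancel_of_imp' fun ha => ?_
  rw [← hJ.sum_right, Fintype.sum_eq_zero_iff_of_nonneg (hJ.nonneg a)] at ha
  exact congrFun ha b

theorem sum_extendWeight (hX : IsMartingalePaths n z w P X)
    (hJ : IsCoupling (w n) (w (n + 1)) J) (ω : Ω) :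
    ∑ e, extendWeight P (X n) (w n) J (ω, e) = P ω := by
  simp only [extendWeight, ← Finset.mul_sum, ← Finset.sum_div, hJ.sum_right]
  by_cases hω : P ω = 0
  · rw [hω, zero_mul]
  · rw [div_self (hX.weight_ne_zero le_rfl hω), mul_one]

theorem sum_extendWeight_mul_snd (hX : IsMartingalePaths n z w P X)
    (hJ : IsCoupling (w n) (w (n + 1)) J) (f : E → ℝ) :
    ∑ ω, extendWeight P (X n) (w n) J ω * f ω.2 = ∑ e, w (n + 1) e * f e := by
  calc ∑ ω, extendWeight P (X n) (w n) J ω * f ω.2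
      = ∑ ω, P ω * ∑ e, J (X n ω) e / w n (X n ω) * f e := by
        simp only [extendWeight, Fintype.sum_prod_type, mul_assoc, Finset.mul_sum]
    _ = ∑ a, w n a * ∑ e, J a e / w n a * f e :=
        hX.marginal n le_rfl fun a => ∑ e, J a e / w n a * f e
    _ = ∑ a, ∑ e, J a e * f e := by
        simp only [Finset.mul_sum, ← mul_assoc, hJ.mul_div_self]
    _ = ∑ e, w (n + 1) e * f e := by
        rw [Finset.sum_comm]
        simp only [← Finset.sum_mul, hJ.sum_left]

theorem IsMartingalePaths.extend (hX : IsMartingalePaths n z w P X) (hw : 0 ≤ w n)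
    (hJ : IsCoupling (w n) (w (n + 1)) J) (hJ_mart : ∀ a, ∑ b, J a b * (z b - z a) = 0) :
    IsMartingalePaths (n + 1) z w (extendWeight P (X n) (w n) J) (extendPath X n) := by
  refine ⟨⟨fun ω => ?_, ?_⟩, fun t ht f => ?_, fun t φ hφ => ?_⟩
  · exact mul_nonneg (hX.mem_stdSimplex.1 _) (div_nonneg (hJ.nonneg _ _) (hw _))
  · rw [Fintype.sum_prod_type]
    simp only [sum_extendWeight hX hJ, hX.mem_stdSimplex.2]
  · rcases ht.lt_or_eq with ht | rfl
    · simp only [extendPath_of_le (Nat.le_of_lt_succ ht), Fintype.sum_prod_type, ← Finset.sum_mul,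
        sum_extendWeight hX hJ, hX.marginal t (Nat.le_of_lt_succ ht)]
    · simp only [extendPath_of_lt n.lt_succ_self, sum_extendWeight_mul_snd hX hJ]
  · have hφ_fst : t ≤ n → ∀ ω e, φ (ω, e) = φ (ω, X 0 ω) := fun ht ω e =>
      hφ (by rw [history_extendPath ht, history_extendPath ht])
    rcases lt_trichotomy t n with ht | rfl | ht
    · simp only [extendPath_of_le ht.le, extendPath_of_le (Nat.succ_le_of_lt ht),
        Fintype.sum_prod_type, hφ_fst ht.le, ← Finset.sum_mul, sum_extendWeight hX hJ]
      refine hX.sum_mul_increment t (fun ω => φ (ω, X 0 ω)) fun ω ω' hω => hφ ?_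
      rw [history_extendPath ht.le, history_extendPath ht.le, hω]
    · simp only [extendPath_of_le le_rfl, extendPath_of_lt (Nat.lt_succ_self _),
        Fintype.sum_prod_type, hφ_fst le_rfl, mul_left_comm _ (φ _), ← Finset.mul_sum,
        sum_extendWeight_mul_sub hJ_mart, mul_zero, Finset.sum_const_zero]
    · simp only [extendPath_of_lt ht, extendPath_of_lt (Nat.lt_succ_of_lt ht), sub_self, mul_zero,
        Finset.sum_const_zero]

end Extension

theorem exists_isMartingalePaths {E : Type} [Fintype E] {T : ℕ} {z : E → ℝ} {w : ℕ → E → ℝ}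
    (hw : ∀ t ≤ T, w t ∈ stdSimplex ℝ E)
    (hconv : ∀ t < T, ConvexOrderLE (w t) z (w (t + 1)) z) :
    ∃ (Ω : Type) (_ : Fintype Ω) (P : Ω → ℝ) (X : ℕ → Ω → E), IsMartingalePaths T z w P X := by
  induction T with
  | zero =>
    exact ⟨E, inferInstance, w 0, fun _ e => e, hw 0 le_rfl,
      fun t ht f => by rw [Nat.le_zero.1 ht], fun t φ _ => by simp⟩
  | succ n ih =>
    obtain ⟨Ω, _, P, X, hX⟩ :=
      ih (fun t ht => hw t (ht.trans n.le_succ)) fun t ht => hconv t (ht.trans n.lt_succ_self)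
    have hwn := hw n n.le_succ
    have : Nonempty E := by
      by_contra hE
      simpa [not_nonempty_iff.1 hE] using hwn.2
    obtain ⟨J, hJ, hJ_mart⟩ :=
      (hconv n n.lt_succ_self).exists_martingale_coupling hwn (hw (n + 1) le_rfl).1
    exact ⟨Ω × E, inferInstance, _, _, hX.extend hwn.1 hJ hJ_mart⟩

end MartingalePaths

section StdSimplex

variable {Ω : Type*} [Fintype Ω] {P : Ω → ℝ} (hP : P ∈ stdSimplex ℝ Ω)

/-- The probability mass function with weights in the standard simplex. -/
noncomputable def stdSimplexPMF : PMF Ω :=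
  .ofFintype (fun ω => ENNReal.ofReal (P ω)) <| by
    rw [← ENNReal.ofReal_sum_of_nonneg fun ω _ => hP.1 ω, hP.2, ENNReal.ofReal_one]

variable [MeasurableSpace Ω] [MeasurableSingletonClass Ω]

theorem integral_stdSimplexPMF (f : Ω → ℝ) :
    ∫ ω, f ω ∂(stdSimplexPMF hP).toMeasure = ∑ ω, P ω * f ω := by
  rw [PMF.integral_eq_sum]
  simp [stdSimplexPMF, hP.1 _]

theorem ae_stdSimplexPMF {p : Ω → Prop} (hp : ∀ ω, P ω ≠ 0 → p ω) :
    ∀ᵐ ω ∂(stdSimplexPMF hP).toMeasure, p ω := by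
  rw [ae_iff, PMF.toMeasure_apply_eq_zero_iff _ (Set.toFinite _).measurableSet, Set.disjoint_left]
  intro ω hω hnp
  refine (PMF.mem_support_iff _ _).1 hω ?_
  simp [stdSimplexPMF, not_imp_comm.1 (hp ω) hnp]

end StdSimplex

section HistoryFiltration

variable {Ω E : Type*}

/-- The filtration generated by a process, on a sample space all of whose subsets are events. -/
def historyFiltration (X : ℕ → Ω → E) : Filtration ℕ (⊤ : MeasurableSpace Ω) where
  seq t := MeasurableSpace.comap (history X t) ⊤
  mono' := by
    rintro s t hst _ ⟨A, -, rfl⟩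
    exact ⟨(fun h (k : Set.Iic s) => h ⟨k, k.2.trans hst⟩) ⁻¹' A, trivial, rfl⟩
  le' _ := le_top

theorem stronglyAdapted_historyFiltration (X : ℕ → Ω → E) (f : ℕ → E → ℝ) :
    StronglyAdapted (historyFiltration X) fun t ω => f t (X t ω) := fun t =>
  Measurable.stronglyMeasurable fun A _ =>
    ⟨(fun h => f t (h ⟨t, Set.self_mem_Iic⟩)) ⁻¹' A, trivial, rfl⟩

/-- The restriction of a filtration to the times `0, …, T`. -/
def restrictFiltration {m : MeasurableSpace Ω} (ℱ : Filtration ℕ m) (T : ℕ) :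
    Filtration (Fin (T + 1)) m where
  seq t := ℱ t
  mono' _ _ hst := ℱ.mono hst
  le' t := ℱ.le t

theorem IsMartingalePaths.martingale [Fintype Ω] [Fintype E] {T : ℕ} {z : E → ℝ} {w : ℕ → E → ℝ}
    {P : Ω → ℝ} {X : ℕ → Ω → E} (hX : IsMartingalePaths T z w P X) :
    letI : MeasurableSpace Ω := ⊤
    Martingale (fun t ω => z (X t ω)) (historyFiltration X)
      (stdSimplexPMF hX.mem_stdSimplex).toMeasure := by
  classical
  let : MeasurableSpace Ω := ⊤
  refine martingale_of_setIntegral_eq_succ (stronglyAdapted_historyFiltration X fun _ => z)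
    (fun t => .of_finite) ?_
  rintro t _ ⟨A, -, rfl⟩
  have hA : MeasurableSet (history X t ⁻¹' A) := trivial
  have hincrement := hX.sum_mul_increment t (fun ω => A.indicator 1 (history X t ω))
    fun ω ω' hω => congrArg (A.indicator 1) hω
  simp only [mul_sub, Finset.sum_sub_distrib, sub_eq_zero] at hincrement
  rw [← integral_indicator hA, ← integral_indicator hA, integral_stdSimplexPMF,
    integral_stdSimplexPMF]
  simpa [Set.indicator_apply] using hincrement.symm

end HistoryFiltration

namespace IsJointLaw

variable {E : Type*} [Fintype E] {T t : ℕ} {ε S₀ : ℝ} {μ : ℕ → Measure ℝ} {x z : E → ℝ}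
  {w : ℕ → E → ℝ}

theorem fst_notMem_of_null (hL : IsJointLaw T ε S₀ μ x z w) (ht : t ∈ Set.Icc 1 T) {s : Set ℝ}
    (hs : μ t s = 0) {e : E} (he : w t e ≠ 0) : x e ∉ s := by
  classical
  intro hes
  have hsum : ∑ e, w t e * s.indicator 1 (x e) = 0 := by
    rw [hL.sum_eq_integral t ht]
    exact integral_eq_zero_of_ae (indicator_meas_zero hs)
  rw [Fintype.sum_eq_zero_iff_of_nonneg fun e => mul_nonneg ((hL.mem_stdSimplex t ht.2).1 e)
    (Set.indicator_nonneg (fun _ _ => zero_le_one) _)] at hsum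
  exact he (by simpa [hes] using congrFun hsum e)

theorem abs_sub_le (hL : IsJointLaw T ε S₀ μ x z w) (hε : 0 ≤ ε) (ht : t ≤ T) {e : E}
    (he : w t e ≠ 0) : |x e - z e| ≤ ε := by
  rcases Nat.eq_zero_or_pos t with rfl | ht₁
  · obtain ⟨hx, hz⟩ := hL.initial e he
    rwa [hx, hz, sub_self, abs_zero]
  · exact hL.dist_le t ⟨ht₁, ht⟩ e he

theorem le_fst (hL : IsJointLaw T ε S₀ μ x z w) (hS₀ : ε ≤ S₀)
    (hμ : ∀ t ∈ Set.Icc 1 T, ∀ᵐ y ∂μ t, ε ≤ y) (ht : t ≤ T) {e : E} (he : w t e ≠ 0) :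
    ε ≤ x e := by
  rcases Nat.eq_zero_or_pos t with rfl | ht₁
  · rwa [(hL.initial e he).1]
  · exact not_not.1 (hL.fst_notMem_of_null ⟨ht₁, ht⟩ (hμ t ⟨ht₁, ht⟩) he)

theorem min_nonneg (hL : IsJointLaw T ε S₀ μ x z w) (hε : 0 ≤ ε) (hS₀ : ε ≤ S₀)
    (hμ : ∀ t ∈ Set.Icc 1 T, ∀ᵐ y ∂μ t, ε ≤ y) (ht : t ≤ T) {e : E} (he : w t e ≠ 0) :
    0 ≤ min (x e) (z e) := by
  have hdist := abs_le.1 (hL.abs_sub_le hε ht he)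
  have hx : ε ≤ x e := hL.le_fst hS₀ hμ ht he
  exact le_min (hε.trans hx) (by linarith [hdist.2])

theorem min_pos (hL : IsJointLaw T ε S₀ μ x z w) (hε : 0 ≤ ε) (hS₀ : 0 < S₀)
    (hμ : ∀ t ∈ Set.Icc 1 T, ∀ᵐ y ∂μ t, ε < y) (ht : t ≤ T) {e : E} (he : w t e ≠ 0) :
    0 < min (x e) (z e) := by
  rcases Nat.eq_zero_or_pos t with rfl | ht₁
  · obtain ⟨hx, hz⟩ := hL.initial e he
    rwa [hx, hz, min_self]
  · have hdist := abs_le.1 (hL.abs_sub_le hε ht he)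
    have hx : ε < x e := not_not.1 (hL.fst_notMem_of_null ⟨ht₁, ht⟩ (hμ t ⟨ht₁, ht⟩) he)
    exact lt_min (hε.trans_lt hx) (by linarith [hdist.2])

end IsJointLaw

section PathModel

variable {D : MarketData} {Ω E : Type} [Fintype Ω] [Fintype E] {z : E → ℝ} {w : ℕ → E → ℝ}
  {P : Ω → ℝ} {X : ℕ → Ω → E}

/-- The model whose discounted reference price is `x ∘ X`, and whose discounted bid and ask prices
are the minimum and the maximum of `x ∘ X` and the martingale `z ∘ X`. -/
noncomputable def pathModel (hX : IsMartingalePaths D.T z w P X) (x : E → ℝ)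
    (hxz : ∀ t ≤ D.T, ∀ e, w t e ≠ 0 → 0 ≤ min (x e) (z e)) : BidAskModel D.T :=
  letI : MeasurableSpace Ω := ⊤
  { Ω := Ω
    finite := inferInstance
    mΩ := ⊤
    P := (stdSimplexPMF hX.mem_stdSimplex).toMeasure
    isProb := inferInstance
    ℱ := restrictFiltration (historyFiltration X) D.T
    bid := fun t ω => D.B t * min (x (X t ω)) (z (X t ω))
    ref := fun t ω => D.B t * x (X t ω)
    ask := fun t ω => D.B t * max (x (X t ω)) (z (X t ω))
    adapted_bid := fun t =>
      stronglyAdapted_historyFiltration X (fun t e => D.B t * min (x e) (z e)) t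
    adapted_ref := fun t => stronglyAdapted_historyFiltration X (fun t e => D.B t * x e) t
    adapted_ask := fun t =>
      stronglyAdapted_historyFiltration X (fun t e => D.B t * max (x e) (z e)) t
    bid_nonneg := fun t => ae_stdSimplexPMF _ fun _ hω =>
      mul_nonneg (D.B_pos t t.is_le).le (hxz t t.is_le _ (hX.weight_ne_zero t.is_le hω))
    bid_le_ref := fun t => .of_forall fun _ =>
      mul_le_mul_of_nonneg_left (min_le_left _ _) (D.B_pos t t.is_le).le
    ref_le_ask := fun t => .of_forall fun _ =>
      mul_le_mul_of_nonneg_left (le_max_left _ _) (D.B_pos t t.is_le).le }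

variable (hX : IsMartingalePaths D.T z w P X) {x : E → ℝ}
  (hxz : ∀ t ≤ D.T, ∀ e, w t e ≠ 0 → 0 ≤ min (x e) (z e))

theorem ae_pathModel (t : Fin (D.T + 1)) {p : E → Prop} (hp : ∀ e, w t e ≠ 0 → p e) :
    ∀ᵐ ω ∂(pathModel hX x hxz).P, p (X t ω) :=
  letI : MeasurableSpace Ω := ⊤
  ae_stdSimplexPMF _ fun _ hω => hp _ (hX.weight_ne_zero t.is_le hω)

theorem integral_pathModel (t : Fin (D.T + 1)) (f : E → ℝ) :
    ∫ ω, f (X t ω) ∂(pathModel hX x hxz).P = ∑ e, w t e * f e :=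
  letI : MeasurableSpace Ω := ⊤
  (integral_stdSimplexPMF hX.mem_stdSimplex _).trans (hX.marginal t t.is_le f)

theorem pathModel_exists_price_system :
    ∃ Sstar : Fin (D.T + 1) → (pathModel hX x hxz).Ω → ℝ,
      (∀ t, ∀ᵐ ω ∂(pathModel hX x hxz).P,
        (pathModel hX x hxz).bid t ω ≤ Sstar t ω ∧ Sstar t ω ≤ (pathModel hX x hxz).ask t ω) ∧
      Martingale (fun (t : Fin (D.T + 1)) ω => (D.B t)⁻¹ * Sstar t ω) (pathModel hX x hxz).ℱ
        (pathModel hX x hxz).P := by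
  have hB : ∀ t : Fin (D.T + 1), 0 < D.B t := fun t => D.B_pos t t.is_le
  refine ⟨fun t ω => D.B t * z (X t ω), fun t => .of_forall fun _ =>
    ⟨mul_le_mul_of_nonneg_left (min_le_right _ _) (hB t).le,
      mul_le_mul_of_nonneg_left (le_max_right _ _) (hB t).le⟩, ?_⟩
  simp only [inv_mul_cancel_left₀ (hB _).ne']
  exact ⟨fun t => hX.martingale.1 t, fun s t hst => hX.martingale.2 s t hst⟩

variable {ε S₀ : ℝ} {R : ℕ → ℝ → ℝ} {μ : ℕ → Measure ℝ}

theorem pathModel_isConsistent (hA : SimplifyingAssumptions D ε S₀ R μ)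
    (hL : IsJointLaw D.T ε S₀ μ x z w) : (pathModel hX x hxz).IsConsistent D := by
  refine ⟨?_, ?_, fun t ht k _ => ?_, pathModel_exists_price_system hX hxz⟩
  · filter_upwards [ae_pathModel hX hxz 0 hL.initial] with ω ⟨hx, hz⟩
    rw [Fin.val_zero] at hx hz
    simp [pathModel, D.B_zero, hA.bid₀_eq, hx, hz]
  · filter_upwards [ae_pathModel hX hxz 0 hL.initial] with ω ⟨hx, hz⟩
    rw [Fin.val_zero] at hx hz
    simp [pathModel, D.B_zero, hA.ask₀_eq, hx, hz]
  · have hprice : ∫ ω, max ((D.B t)⁻¹ * (pathModel hX x hxz).ref t ω - k) 0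
        ∂(pathModel hX x hxz).P = R t k := by
      rw [hA.R_eq t ht t.is_le, callFunction,
        ← hL.sum_eq_integral t ⟨ht, t.is_le⟩ fun y => max (y - k) 0,
        ← integral_pathModel hX hxz t fun e => max (x e - k) 0]
      simp only [pathModel, inv_mul_cancel_left₀ (D.B_pos t t.is_le).ne']
    rw [hprice, hA.optBid_eq t ht t.is_le, hA.optAsk_eq t ht t.is_le]
    exact ⟨le_rfl, le_rfl⟩

theorem pathModel_isEpsConsistent (hε : 0 ≤ ε) (hS₀ : ε ≤ S₀)
    (hA : SimplifyingAssumptions D ε S₀ R μ) (hL : IsJointLaw D.T ε S₀ μ x z w) :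
    (pathModel hX x hxz).IsEpsConsistent D ε := by
  refine ⟨pathModel_isConsistent hX hxz hA hL, fun t => ?_, fun t => ?_⟩
  · filter_upwards [ae_pathModel hX hxz t fun e => hL.abs_sub_le hε t.is_le] with ω hω
    simp only [pathModel]
    rw [← mul_sub, mul_comm ε, max_sub_min_eq_abs']
    exact mul_le_mul_of_nonneg_left hω (D.B_pos t t.is_le).le
  · filter_upwards [ae_pathModel hX hxz t fun e =>
      hL.le_fst hS₀ (fun _ => hA.ae_ge) t.is_le] with ω hω
    simp only [pathModel]
    rw [mul_comm ε]
    exact mul_le_mul_of_nonneg_left hω (D.B_pos t t.is_le).le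

theorem pathModel_positive (hpos : ∀ t ≤ D.T, ∀ e, w t e ≠ 0 → 0 < min (x e) (z e)) :
    (pathModel hX x hxz).Positive := fun t => by
  filter_upwards [ae_pathModel hX hxz t (hpos t t.is_le)] with ω hω
  exact mul_pos (D.B_pos t t.is_le) hω

end PathModel

theorem SimplifyingAssumptions.ae_gt {D : MarketData} {ε S₀ : ℝ} {R : ℕ → ℝ → ℝ}
    {μ : ℕ → Measure ℝ} (hA : SimplifyingAssumptions D ε S₀ R μ) {t : ℕ} (ht : t ∈ Set.Icc 1 D.T)
    (hμ : μ t {ε} = 0) : ∀ᵐ y ∂μ t, ε < y := by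
  filter_upwards [hA.ae_ge ht, measure_eq_zero_iff_ae_notMem.1 hμ] with y hy hne
  exact lt_of_le_of_ne hy (Ne.symm hne)

theorem exists_model_of_pathConditions {D : MarketData} {ε S₀ : ℝ} {R : ℕ → ℝ → ℝ}
    {μ : ℕ → Measure ℝ} (hε : 0 ≤ ε) (hS₀ : ε ≤ S₀) (hA : SimplifyingAssumptions D ε S₀ R μ)
    (hP : PathConditions D.T R ε S₀) :
    ∃ M : BidAskModel D.T, M.IsEpsConsistent D ε ∧
      ((∀ t, 1 ≤ t → t ≤ D.T → μ t {ε} = 0) → M.Positive) := by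
  obtain ⟨E, _, x, z, w, hL⟩ := exists_isJointLaw hε hA hP
  obtain ⟨Ω, _, P, X, hX⟩ := exists_isMartingalePaths hL.mem_stdSimplex hL.convexOrder
  have hxz : ∀ t ≤ D.T, ∀ e, w t e ≠ 0 → 0 ≤ min (x e) (z e) := fun t ht e =>
    hL.min_nonneg hε hS₀ (fun _ => hA.ae_ge) ht
  refine ⟨pathModel hX x hxz, pathModel_isEpsConsistent hX hxz hε hS₀ hA hL, fun hμ =>
    pathModel_positive hX hxz fun t ht e => ?_⟩
  have hS₀_pos : 0 < S₀ := hA.bid₀_eq ▸ D.bid₀_pos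
  exact hL.min_pos hε hS₀_pos (fun t ht => hA.ae_gt ht (hμ t ht.1 ht.2)) ht

/-- Under the simplifying assumptions, the four families of inequalities are necessary and
sufficient for the existence of `ε`-consistent models. The condition `ε ≤ S₀` is the lower bound on
the reference price at time `0`. If no `μ t` charges the point `ε`, the models can be taken with
strictly positive bid prices; in general, bid prices must be allowed to vanish. -/
theorem mainTheorem2 (D : MarketData) (ε S₀ : ℝ) (R : ℕ → ℝ → ℝ) (μ : ℕ → Measure ℝ)
    (hε : 0 ≤ ε) (hS₀ : ε ≤ S₀) (hA : SimplifyingAssumptions D ε S₀ R μ) :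
    (EpsConsistent D ε → PathConditions D.T R ε S₀) ∧
    ((∀ t, 1 ≤ t → t ≤ D.T → μ t {ε} = 0) →
      (EpsConsistent D ε ↔ PathConditions D.T R ε S₀)) ∧
    (EpsConsistentNonneg D ε ↔ PathConditions D.T R ε S₀) := by
  have hnec : EpsConsistent D ε → PathConditions D.T R ε S₀ := fun ⟨M, _, hM⟩ =>
    pathConditions_of_epsConsistentNonneg hA hε ⟨M, hM⟩
  refine ⟨hnec, fun hμ => ⟨hnec, fun hP => ?_⟩,
    pathConditions_of_epsConsistentNonneg hA hε, fun hP => ?_⟩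
  · obtain ⟨M, hM, hpos⟩ := exists_model_of_pathConditions hε hS₀ hA hP
    exact ⟨M, hpos hμ, hM⟩
  · obtain ⟨M, hM, _⟩ := exists_model_of_pathConditions hε hS₀ hA hP
    exact ⟨M, hM⟩
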